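/- For $\gamma\in\mathbb C$ with $\operatorname{Re}\gamma>-1$ and $x\in\mathbb R$ let $$\mathrm{Ai}_\gamma(x)=\frac1\pi\int_0^\infty \sigma^\gamma\cos\Big(\frac{\sigma^3}3+x\sigma-\frac{\gamma\pi}2\Big)\,d\sigma,\qquad \mathrm{Gi}_\gamma(x)=\frac1\pi\int_0^\infty \sigma^\gamma\sin\Big(\frac{\sigma^3}3+x\sigma-\frac{\gamma\pi}2\Big)\,d\sigma,\qquad \mathrm{Hi}_\gamma(x)=\frac1\pi\int_0^\infty \sigma^\gamma e^{-\sigma^3/3+\sigma x}\,d\sigma ,$$ where the first two integrals are oscillatory integrals, i.e. $\lim_{\varepsilon\to0+}$ of the absolutely convergent integrals with the additional factor $e^{-\varepsilon\sigma}$. These limits exist, the third integral converges absolutely, and for $-1<\operatorname{Re}\gamma<2$ the first two integrals also converge, to the same values, as improper integrals $\lim_{R\to\infty}\int_0^R$. Write $[f,g]=fg'-f'g$. (i) If $-1<\operatorname{Re}\gamma<0$ (so that $\operatorname{Re}(-1-\gamma)>-1$ as well), then on $\mathbb R$ $$[\mathrm{Ai}_\gamma,\mathrm{Gi}_\gamma]=\frac{\Gamma(1+\gamma)}\pi\,\mathrm{Ai}_{-1-\gamma},$$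 $$[\mathrm{Ai}_\gamma,\mathrm{Hi}_\gamma]=\frac{\Gamma(1+\gamma)}\pi\big(-\cos(\pi\gamma)\,\mathrm{Ai}_{-1-\gamma}-\sin(\pi\gamma)\,\mathrm{Gi}_{-1-\gamma}\big),$$ $$[\mathrm{Gi}_\gamma,\mathrm{Hi}_\gamma]=\frac{\Gamma(1+\gamma)}\pi\big(\sin(\pi\gamma)\,\mathrm{Ai}_{-1-\gamma}-\cos(\pi\gamma)\,\mathrm{Gi}_{-1-\gamma}+\mathrm{Hi}_{-1-\gamma}\big).$$ (ii) If $\operatorname{Re}\gamma>-1$, then the Wronskian determinant of $(\mathrm{Ai}_\gamma,\mathrm{Gi}_\gamma,\mathrm{Hi}_\gamma)$ is equal to $\Gamma(\gamma+1)/\pi^2$ at every $x\in\mathbb R$, and the three functions form a fundamental system for $(1+\gamma)u+xu'-u'''=0$ on $\mathbb R$: they are linearly independent over $\mathbb C$, and the $C^3$ solutions $u:\mathbb R\to\mathbb C$ are exactly their complex linear combinations. -/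

import Mathlib

open Filter Topology MeasureTheory Set

namespace GenAiry

noncomputable section

/-- `HasOscIntegral f a`: the integral of `f` over `(0, ∞)` exists and equals `a` as an oscillatory
integral, that is, it is the limit as `ε` tends to `0+` of the absolutely convergent integrals
with the regularizing factor `exp (-ε σ)`. -/
def HasOscIntegral (f : ℝ → ℂ) (a : ℂ) : Prop :=
  (∀ ε : ℝ, 0 < ε → IntegrableOn (fun σ : ℝ => (Real.exp (-ε * σ) : ℂ) * f σ) (Ioi 0)) ∧
    Tendsto (fun ε : ℝ => ∫ σ in Ioi (0 : ℝ), (Real.exp (-ε * σ) : ℂ) * f σ) (𝓝[>] 0) (𝓝 a)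

/-- The value of the oscillatory integral of `f` over `(0, ∞)`. -/
def oscIntegral (f : ℝ → ℂ) : ℂ :=
  limUnder (𝓝[>] (0 : ℝ)) (fun ε : ℝ => ∫ σ in Ioi (0 : ℝ), (Real.exp (-ε * σ) : ℂ) * f σ)

/-- The phase `σ³/3 + x σ - γ π / 2`. -/
def phase (γ : ℂ) (x σ : ℝ) : ℂ :=
  (σ : ℂ) ^ 3 / 3 + (x : ℂ) * (σ : ℂ) - γ * (Real.pi : ℂ) / 2

/-- The integrand `σ ^ γ cos (σ³/3 + x σ - γ π / 2)` of `Ai_γ(x)`. -/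
def aiIntegrand (γ : ℂ) (x σ : ℝ) : ℂ := (σ : ℂ) ^ γ * Complex.cos (phase γ x σ)

/-- The integrand `σ ^ γ sin (σ³/3 + x σ - γ π / 2)` of `Gi_γ(x)`. -/
def giIntegrand (γ : ℂ) (x σ : ℝ) : ℂ := (σ : ℂ) ^ γ * Complex.sin (phase γ x σ)

/-- The integrand `σ ^ γ exp (-σ³/3 + σ x)` of `Hi_γ(x)`. -/
def hiIntegrand (γ : ℂ) (x σ : ℝ) : ℂ :=
  (σ : ℂ) ^ γ * Complex.exp (-(σ : ℂ) ^ 3 / 3 + (σ : ℂ) * (x : ℂ))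

/-- The generalized Airy function `Ai_γ`, for `Re γ > -1`. -/
def Ai (γ : ℂ) (x : ℝ) : ℂ := 1 / (Real.pi : ℂ) * oscIntegral (aiIntegrand γ x)

/-- The generalized Scorer function `Gi_γ`, for `Re γ > -1`. -/
def Gi (γ : ℂ) (x : ℝ) : ℂ := 1 / (Real.pi : ℂ) * oscIntegral (giIntegrand γ x)

/-- The generalized Scorer function `Hi_γ`, for `Re γ > -1`. -/
def Hi (γ : ℂ) (x : ℝ) : ℂ := 1 / (Real.pi : ℂ) * ∫ σ in Ioi (0 : ℝ), hiIntegrand γ x σ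

/-- The bracket `[f, g] = f g' - f' g`. -/
def bracket (f g : ℝ → ℂ) (x : ℝ) : ℂ := f x * deriv g x - deriv f x * g x

/-- The Wronskian determinant of three functions. -/
def wronskian (u : Fin 3 → ℝ → ℂ) (x : ℝ) : ℂ :=
  Matrix.det (Matrix.of fun i j : Fin 3 => iteratedDeriv (i : ℕ) (u j) x)

/-- Classical solutions on the real line of `(1 + γ) u + x u' - u''' = 0`. -/
def IsSolution (γ : ℂ) (u : ℝ → ℂ) : Prop :=
  ContDiff ℝ 3 u ∧
    ∀ x : ℝ, (1 + γ) * u x + (x : ℂ) * deriv u x - iteratedDeriv 3 u x = 0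

/-- `u 0, u 1, u 2` form a fundamental system for `(1 + γ) u + x u' - u''' = 0`: they are linearly
independent and the solutions are exactly their linear combinations. -/
def IsFundamentalSystem (γ : ℂ) (u : Fin 3 → ℝ → ℂ) : Prop :=
  LinearIndependent ℂ u ∧
    ∀ v : ℝ → ℂ, IsSolution γ v ↔ v ∈ Submodule.span ℂ (Set.range u)

end

end GenAiry

namespace GenAiry

/-! Everything reduces to the entire function `F γ y`, the integral of `σ ^ γ exp (-σ³/3 + y σ)`.
Rotating the ray of integration (`kernelInt_eq_F`, `hasOscIntegral_kernel`) turns the oscillatory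
integrals of `σ ^ γ exp (± i phase)` into constant multiples of `F γ (ω x)` and `F γ (ω² x)`, where
`ω` is a primitive cube root of unity. So `Ai γ`, `Gi γ`, `Hi γ` are combinations (`rayComb`) of `F
γ` along the rays through `1`, `ω`, `ω²`.

Differentiating `F γ` raises `γ` by one, and integrating a total derivative gives `F_add_three`,
which is the differential equation; it is invariant under `x ↦ ω x`. The equation has no
second-order term, so Wronskians are constant and can be computed at `0`. There the jets consist of
moments `F γ 0`, which are Gamma values at thirds, and the triplication formula evaluates their
product. A nonzero Wronskian yields the fundamental system by Cramer's rule, and with it uniqueness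
for the initial value problem.

The bracket of two solutions solves the equation with parameter `-1 - γ`, so it is identified by its
2-jet at `0`. The moments for `γ` and `-1 - γ` are linked by the reflection formula, which leaves
finite identities between phases (`bracket_rayComb`).

For improper integrals, integration by parts shows that a limit exists, and an Abelian theorem
identifies it with the oscillatory value. -/

/-! ### Integrability of the kernel. -/

/-- The kernel `σ ^ γ exp (-a σ³/3 + y σ)`. -/
noncomputable def kernel (γ a y : ℂ) (σ : ℝ) : ℂ :=
  (σ : ℂ) ^ γ * Complex.exp (-a * (σ : ℂ) ^ 3 / 3 + y * (σ : ℂ))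

/-- The integral of the kernel over `(0, ∞)`. -/
noncomputable def kernelInt (γ a y : ℂ) : ℂ := ∫ σ in Ioi (0 : ℝ), kernel γ a y σ

lemma norm_kernel (γ a y : ℂ) {σ : ℝ} (hσ : 0 < σ) :
    ‖kernel γ a y σ‖ = σ ^ γ.re * Real.exp (-a.re * σ ^ 3 / 3 + y.re * σ) := by
  have h : (-a * (σ : ℂ) ^ 3 / 3 + y * (σ : ℂ)) =
      -a * ((σ ^ 3 / 3 : ℝ) : ℂ) + y * (σ : ℂ) := by push_cast; ring
  rw [kernel, norm_mul, Complex.norm_cpow_eq_rpow_re_of_pos hσ, Complex.norm_exp, h]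
  congr 2
  rw [Complex.add_re, Complex.re_mul_ofReal, Complex.re_mul_ofReal, Complex.neg_re]
  ring

lemma continuousOn_kernel (γ a y : ℂ) : ContinuousOn (kernel γ a y) (Ioi 0) := by
  unfold kernel
  refine ContinuousOn.mul (fun σ hσ => ?_) (by fun_prop)
  exact ((continuousAt_cpow_const (Complex.ofReal_mem_slitPlane.2 hσ)).comp
    Complex.continuous_ofReal.continuousAt).continuousWithinAt

lemma aestronglyMeasurable_kernel (γ a y : ℂ) :
    AEStronglyMeasurable (kernel γ a y) (volume.restrict (Ioi 0)) :=
  (continuousOn_kernel γ a y).aestronglyMeasurable measurableSet_Ioi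

/-- Split at `σ² = |b| / c`: above it the cubic dominates, below it `σ ≤ 1 + σ²` bounds the linear
term. Half of the cubic decay thus absorbs any linear exponent. -/
lemma linear_le_cubic_add_const {c : ℝ} (hc : 0 < c) (b : ℝ) {σ : ℝ} (hσ : 0 < σ) :
    b * σ ≤ c * σ ^ 3 + |b| * (1 + |b| / c) := by
  have h1 : b * σ ≤ |b| * σ := mul_le_mul_of_nonneg_right (le_abs_self b) hσ.le
  have hb := abs_nonneg b
  have hd : |b| / c * c = |b| := div_mul_cancel₀ _ hc.ne'
  have hd0 : 0 ≤ |b| / c := by positivity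
  rcases le_total (σ ^ 2) (|b| / c) with h | h
  · have : |b| * σ ≤ |b| * (1 + |b| / c) :=
      mul_le_mul_of_nonneg_left (by nlinarith) hb
    have : 0 ≤ c * σ ^ 3 := by positivity
    linarith
  · have : |b| * σ ≤ c * σ ^ 3 := by
      have h2 : |b| ≤ c * σ ^ 2 := by
        rw [← hd]; nlinarith
      nlinarith
    have : 0 ≤ |b| * (1 + |b| / c) := by positivity
    linarith

lemma integrableOn_rpow_mul_exp_cubic {s c : ℝ} (hs : -1 < s) (hc : 0 < c) (b : ℝ) :
    IntegrableOn (fun σ : ℝ => σ ^ s * Real.exp (-c * σ ^ 3 / 3 + b * σ)) (Ioi 0) := by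
  have h := (integrableOn_rpow_mul_exp_neg_mul_rpow hs (p := 3) (by norm_num)
    (b := c / 6) (by positivity)).mul_const (Real.exp (|b| * (1 + |b| / (c / 6))))
  refine Integrable.mono' h ?_ ?_
  · refine ContinuousOn.aestronglyMeasurable (fun σ hσ => ?_) measurableSet_Ioi
    exact ((Real.continuousAt_rpow_const σ s (Or.inl (ne_of_gt hσ))).mul
      (by fun_prop)).continuousWithinAt
  · refine (ae_restrict_iff' measurableSet_Ioi).2 (Eventually.of_forall fun σ hσ => ?_)
    have hσ : 0 < σ := hσ
    have h3 : σ ^ (3 : ℝ) = σ ^ 3 := by exact_mod_cast Real.rpow_natCast σ 3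
    have hl := linear_le_cubic_add_const (c := c / 6) (by positivity) b hσ
    rw [Real.norm_of_nonneg (by positivity), mul_assoc, ← Real.exp_add, h3]
    refine mul_le_mul_of_nonneg_left (Real.exp_le_exp.2 ?_) (by positivity)
    linarith

lemma integrableOn_kernel {γ a : ℂ} (hγ : -1 < γ.re) (ha : 0 < a.re) (y : ℂ) :
    IntegrableOn (kernel γ a y) (Ioi 0) := by
  refine Integrable.mono' (integrableOn_rpow_mul_exp_cubic hγ ha y.re)
    (aestronglyMeasurable_kernel γ a y) ?_
  exact (ae_restrict_iff' measurableSet_Ioi).2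
    (Eventually.of_forall fun σ hσ => (norm_kernel γ a y hσ).le)

lemma integrableOn_rpow_mul_exp_neg {s b : ℝ} (hs : -1 < s) (hb : b < 0) :
    IntegrableOn (fun σ : ℝ => σ ^ s * Real.exp (b * σ)) (Ioi 0) := by
  have h := integrableOn_rpow_mul_exp_neg_mul_rpow hs (p := 1) one_pos (b := -b) (by linarith)
  simpa using h

lemma norm_kernel_le {γ a : ℂ} (ha : 0 ≤ a.re) (y : ℂ) {σ : ℝ} (hσ : 0 < σ) :
    ‖kernel γ a y σ‖ ≤ σ ^ γ.re * Real.exp (y.re * σ) := by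
  rw [norm_kernel γ a y hσ]
  have : 0 ≤ a.re * σ ^ 3 := by positivity
  gcongr
  linarith

/-- On the boundary `Re a = 0` the cubic gives no decay; the factor `exp (y σ)`, later `exp (-ε σ)`,
supplies it. -/
lemma integrableOn_kernel_of_neg {γ a y : ℂ} (hγ : -1 < γ.re) (ha : 0 ≤ a.re) (hy : y.re < 0) :
    IntegrableOn (kernel γ a y) (Ioi 0) := by
  refine Integrable.mono' (integrableOn_rpow_mul_exp_neg hγ hy)
    (aestronglyMeasurable_kernel γ a y) ?_
  exact (ae_restrict_iff' measurableSet_Ioi).2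
    (Eventually.of_forall fun σ hσ => norm_kernel_le ha y hσ)

/-! ### Differentiation in the parameters and the recurrence in `γ`. -/

/-- Differentiation under the integral sign for `z ↦ ∫ f exp (z g)`. -/
lemma hasDerivAt_integral_mul_exp {α : Type*} [MeasurableSpace α] {μ : Measure α} {f : α → ℂ}
    {g : α → ℝ} (hf : AEStronglyMeasurable f μ) (hg : AEStronglyMeasurable g μ) {z₀ : ℂ} {δ : ℝ}
    (hδ : 0 < δ)
    (h₁ : Integrable (fun s => f s * Complex.exp ((z₀ + (2 * δ : ℝ)) * g s)) μ)
    (h₂ : Integrable (fun s => f s * Complex.exp ((z₀ - (2 * δ : ℝ)) * g s)) μ) :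
    HasDerivAt (fun z : ℂ => ∫ s, f s * Complex.exp (z * g s) ∂μ)
      (∫ s, f s * (g s * Complex.exp (z₀ * g s)) ∂μ) z₀ := by
  have hgC : AEStronglyMeasurable (fun s => (g s : ℂ)) μ :=
    Complex.continuous_ofReal.comp_aestronglyMeasurable hg
  have hmeas : ∀ z : ℂ, AEStronglyMeasurable (fun s => f s * Complex.exp (z * g s)) μ := fun z =>
    hf.mul (Complex.continuous_exp.comp_aestronglyMeasurable (hgC.const_mul z))
  -- For `z` within `δ` of `z₀`, the two endpoints `z₀ ± 2δ` leave a spare factor `exp (δ |g|)`. It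
  -- absorbs the `g` produced by differentiation, since `δ |g| ≤ exp (δ |g|)`; hence the `δ⁻¹` in
  -- the bound.
  have key : ∀ (z : ℂ) (s : α), |z.re - z₀.re| ≤ δ →
      Real.exp (z.re * g s + δ * |g s|) ≤
        Real.exp ((z₀.re + 2 * δ) * g s) + Real.exp ((z₀.re - 2 * δ) * g s) := by
    intro z s hz
    rw [abs_le] at hz
    rcases le_total 0 (g s) with h | h
    · rw [abs_of_nonneg h]
      have : Real.exp (z.re * g s + δ * g s) ≤ Real.exp ((z₀.re + 2 * δ) * g s) :=
        Real.exp_le_exp.2 (by nlinarith)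
      have := Real.exp_pos ((z₀.re - 2 * δ) * g s)
      linarith
    · rw [abs_of_nonpos h]
      have : Real.exp (z.re * g s + δ * -g s) ≤ Real.exp ((z₀.re - 2 * δ) * g s) :=
        Real.exp_le_exp.2 (by nlinarith)
      have := Real.exp_pos ((z₀.re + 2 * δ) * g s)
      linarith
  have hnorm : ∀ (z : ℂ) (s : α), ‖Complex.exp (z * g s)‖ = Real.exp (z.re * g s) := by
    intro z s; rw [Complex.norm_exp, Complex.re_mul_ofReal]
  have hb := h₁.norm.add h₂.norm
  have hball : ∀ z ∈ Metric.ball z₀ δ, |z.re - z₀.re| ≤ δ := fun z hz => by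
    rw [← Complex.sub_re]
    exact (Complex.abs_re_le_norm _).trans (by simpa [dist_eq_norm] using (Metric.mem_ball.1 hz).le)
  refine (hasDerivAt_integral_of_dominated_loc_of_deriv_le (Metric.ball_mem_nhds z₀ hδ)
    (Eventually.of_forall hmeas) ?_ (F' := fun z s => f s * (g s * Complex.exp (z * g s))) ?_
    (bound := fun s => δ⁻¹ * (‖f s * Complex.exp ((z₀ + (2 * δ : ℝ)) * g s)‖ +
      ‖f s * Complex.exp ((z₀ - (2 * δ : ℝ)) * g s)‖)) ?_ (hb.const_mul δ⁻¹) ?_).2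
  · refine Integrable.mono' hb (hmeas z₀) (Eventually.of_forall fun s => ?_)
    have := key z₀ s (by simpa using hδ.le)
    have h0 : Real.exp (z₀.re * g s) ≤ Real.exp (z₀.re * g s + δ * |g s|) :=
      Real.exp_le_exp.2 (le_add_of_nonneg_right (by positivity))
    simp only [norm_mul, hnorm, Pi.add_apply, ← mul_add]
    gcongr
    simp only [Complex.add_re, Complex.sub_re, Complex.ofReal_re]
    linarith
  · exact hf.mul (hgC.mul (Complex.continuous_exp.comp_aestronglyMeasurable (hgC.const_mul z₀)))
  · refine Eventually.of_forall fun s z hz => ?_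
    have := key z s (hball z hz)
    have h0 : δ * |g s| * Real.exp (z.re * g s) ≤ Real.exp (z.re * g s + δ * |g s|) := by
      rw [add_comm, Real.exp_add]
      gcongr
      linarith [Real.add_one_le_exp (δ * |g s|)]
    simp only [norm_mul, hnorm, ← mul_add, Complex.norm_real, Real.norm_eq_abs]
    rw [mul_left_comm δ⁻¹]
    refine mul_le_mul_of_nonneg_left ?_ (norm_nonneg _)
    simp only [Complex.add_re, Complex.sub_re, Complex.ofReal_re]
    rw [le_inv_mul_iff₀ hδ]
    linarith
  · refine Eventually.of_forall fun s z _ => ?_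
    have h : HasDerivAt (fun z : ℂ => z * (g s : ℂ)) (g s : ℂ) z := by
      simpa using (hasDerivAt_id z).mul_const (g s : ℂ)
    have := (h.cexp).const_mul (f s)
    simpa [mul_comm, mul_left_comm, mul_assoc] using this

lemma kernel_add_one (γ a y : ℂ) {σ : ℝ} (hσ : 0 < σ) :
    kernel (γ + 1) a y σ = σ * kernel γ a y σ := by
  have : (σ : ℂ) ≠ 0 := by exact_mod_cast hσ.ne'
  rw [kernel, kernel, Complex.cpow_add _ _ this, Complex.cpow_one]; ring

lemma kernel_add_three (γ a y : ℂ) {σ : ℝ} (hσ : 0 < σ) :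
    kernel (γ + 3) a y σ = σ ^ 3 * kernel γ a y σ := by
  have : (σ : ℂ) ≠ 0 := by exact_mod_cast hσ.ne'
  rw [kernel, kernel, Complex.cpow_add _ _ this, ← Complex.cpow_natCast]; push_cast; ring

lemma hasDerivAt_kernelInt {γ a : ℂ} (hγ : -1 < γ.re) (ha : 0 < a.re) (y : ℂ) :
    HasDerivAt (fun y => kernelInt γ a y) (kernelInt (γ + 1) a y) y := by
  have e : ∀ (z : ℂ) (s : ℝ), kernel γ a 0 s * Complex.exp (z * s) = kernel γ a z s := by
    intro z s
    rw [kernel, kernel, mul_assoc, ← Complex.exp_add]; congr 2; ring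
  have := hasDerivAt_integral_mul_exp (μ := volume.restrict (Ioi 0)) (f := kernel γ a 0)
    (g := fun s => s) (aestronglyMeasurable_kernel γ a 0) measurable_id.aestronglyMeasurable
    (z₀ := y) one_pos (by simp only [e]; exact integrableOn_kernel hγ ha _)
    (by simp only [e]; exact integrableOn_kernel hγ ha _)
  simp only [e] at this
  refine this.congr_deriv ?_
  rw [kernelInt]
  refine setIntegral_congr_fun measurableSet_Ioi fun s (hs : 0 < s) => ?_
  rw [kernel_add_one _ _ _ hs, mul_left_comm, e]

lemma differentiableAt_kernelInt_left {γ a : ℂ} (hγ : -1 < γ.re) (ha : 0 < a.re) (y : ℂ) :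
    DifferentiableAt ℂ (fun a => kernelInt γ a y) a := by
  have e : ∀ (z : ℂ) (s : ℝ),
      kernel γ 0 y s * Complex.exp (z * (-s ^ 3 / 3 : ℝ)) = kernel γ z y s := by
    intro z s
    rw [kernel, kernel, mul_assoc, ← Complex.exp_add]; congr 2; push_cast; ring
  have := hasDerivAt_integral_mul_exp (μ := volume.restrict (Ioi 0)) (f := kernel γ 0 y)
    (g := fun s => -s ^ 3 / 3) (aestronglyMeasurable_kernel γ 0 y)
    (by fun_prop : Continuous fun s : ℝ => -s ^ 3 / 3).aestronglyMeasurable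
    -- With this `δ` the points `a ± 2δ` stay in the open right half-plane.
    (z₀ := a) (δ := a.re / 4) (by positivity)
    (by simp only [e]; exact integrableOn_kernel hγ (by simp; linarith) _)
    (by simp only [e]; exact integrableOn_kernel hγ (by simp; linarith) _)
  simp only [e] at this
  exact this.differentiableAt

lemma tendsto_kernel_zero {γ : ℂ} (hγ : 0 < γ.re) (a y : ℂ) :
    Tendsto (kernel γ a y) (𝓝[>] 0) (𝓝 0) := by
  have h1 : Tendsto (fun σ : ℝ => σ ^ γ.re * Real.exp (-a.re * σ ^ 3 / 3 + y.re * σ)) (𝓝[>] 0)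
      (𝓝 0) := by
    have h : ContinuousAt (fun σ : ℝ =>
        σ ^ γ.re * Real.exp (-a.re * σ ^ 3 / 3 + y.re * σ)) 0 :=
      (Real.continuousAt_rpow_const 0 γ.re (Or.inr hγ.le)).mul (by fun_prop)
    have := h.tendsto.mono_left (nhdsWithin_le_nhds (s := Ioi 0))
    simpa [Real.zero_rpow hγ.ne'] using this
  refine squeeze_zero_norm' ?_ h1
  filter_upwards [self_mem_nhdsWithin] with σ hσ using (norm_kernel γ a y hσ).le

lemma hasDerivAt_kernel (γ a y : ℂ) {σ : ℝ} (hσ : 0 < σ) :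
    HasDerivAt (kernel (γ + 1) a y)
      ((γ + 1) * kernel γ a y σ - a * kernel (γ + 3) a y σ + y * kernel (γ + 1) a y σ) σ := by
  have h0 : (σ : ℂ) ≠ 0 := by exact_mod_cast hσ.ne'
  have h1 : HasDerivAt (fun z : ℂ => z ^ (γ + 1) * Complex.exp (-a * z ^ 3 / 3 + y * z))
      ((γ + 1) * (σ : ℂ) ^ γ * Complex.exp (-a * (σ : ℂ) ^ 3 / 3 + y * σ) +
        (σ : ℂ) ^ (γ + 1) * (Complex.exp (-a * (σ : ℂ) ^ 3 / 3 + y * σ) *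
          (-a * (σ : ℂ) ^ 2 + y))) (σ : ℂ) := by
    have hA : HasDerivAt (fun z : ℂ => z ^ (γ + 1)) ((γ + 1) * (σ : ℂ) ^ γ) (σ : ℂ) := by
      have := (hasDerivAt_id (σ : ℂ)).cpow_const (c := γ + 1)
        (Complex.ofReal_mem_slitPlane.2 hσ)
      simpa using this
    have hB : HasDerivAt (fun z : ℂ => -a * z ^ 3 / 3 + y * z) (-a * (σ : ℂ) ^ 2 + y) (σ : ℂ) := by
      have := (((hasDerivAt_pow 3 (σ : ℂ)).const_mul (-a)).div_const 3).add
        ((hasDerivAt_id (σ : ℂ)).const_mul y)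
      refine this.congr_deriv ?_
      push_cast; ring
    exact hA.mul hB.cexp
  refine h1.comp_ofReal.congr_deriv ?_
  rw [kernel_add_three _ _ _ hσ, kernel_add_one _ _ _ hσ, kernel,
    Complex.cpow_add _ _ h0, Complex.cpow_one]
  ring

/-- The derivative of `kernel (γ + 1) a y` integrates to zero, because both boundary terms vanish.
For `a = 1` this is the third-order equation for `F γ`. -/
lemma kernelInt_add_three {γ a : ℂ} (hγ : -1 < γ.re) (ha : 0 < a.re) (y : ℂ) :
    a * kernelInt (γ + 3) a y = (γ + 1) * kernelInt γ a y + y * kernelInt (γ + 1) a y := by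
  have i0 := integrableOn_kernel hγ ha y
  have i1 := integrableOn_kernel (γ := γ + 1) (by simp; linarith) ha y
  have i3 := integrableOn_kernel (γ := γ + 3) (by simp; linarith) ha y
  have i4 := ((i0.const_mul (γ + 1)).sub (i3.const_mul a)).add (i1.const_mul y)
  have hd : ∀ σ ∈ Ioi (0 : ℝ), HasDerivAt (kernel (γ + 1) a y) _ σ :=
    fun σ hσ => hasDerivAt_kernel γ a y hσ
  have htop : Tendsto (kernel (γ + 1) a y) atTop (𝓝 0) :=
    tendsto_zero_of_hasDerivAt_of_integrableOn_Ioi hd i4 i1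
  have hbot : Tendsto (kernel (γ + 1) a y) (𝓝[>] 0) (𝓝 0) :=
    tendsto_kernel_zero (by simp; linarith) a y
  -- Updating the value at `0` to the right-hand limit makes continuity there immediate.
  have key := integral_Ioi_of_hasDerivAt_of_tendsto (a := (0 : ℝ)) (m := 0)
    (f := Function.update (kernel (γ + 1) a y) 0 0) (f' := fun σ =>
    (γ + 1) * kernel γ a y σ - a * kernel (γ + 3) a y σ + y * kernel (γ + 1) a y σ) ?_ ?_ i4 ?_
  · rw [integral_add, integral_sub, integral_const_mul, integral_const_mul,
      integral_const_mul] at key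
    · simp only [Function.update_self, sub_zero] at key
      simp only [kernelInt]
      linear_combination -key
    · exact i0.const_mul _
    · exact i3.const_mul _
    · exact (i0.const_mul _).sub (i3.const_mul _)
    · exact i1.const_mul _
  · rw [continuousWithinAt_update_same]
    refine hbot.mono_left (nhdsWithin_mono _ ?_)
    intro σ hσ
    exact lt_of_le_of_ne hσ.1 (Ne.symm hσ.2)
  · intro σ hσ
    refine (hd σ hσ).congr_of_eventuallyEq ?_
    filter_upwards [eventually_ne_nhds (ne_of_gt hσ)] with s hs
    simp [Function.update_of_ne hs]
  · refine htop.congr' ?_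
    filter_upwards [eventually_ne_atTop 0] with s hs
    simp [Function.update_of_ne hs]

/-! ### The function `F` and rotation of the ray. -/

/-- The entire function `F_γ(y) = ∫ σ ^ γ exp (-σ³/3 + y σ)`. -/
noncomputable def F (γ y : ℂ) : ℂ := kernelInt γ 1 y

lemma hasDerivAt_F {γ : ℂ} (hγ : -1 < γ.re) (y : ℂ) : HasDerivAt (F γ) (F (γ + 1) y) y :=
  hasDerivAt_kernelInt hγ (by simp) y

lemma F_add_three {γ : ℂ} (hγ : -1 < γ.re) (y : ℂ) :
    F (γ + 3) y = (γ + 1) * F γ y + y * F (γ + 1) y := by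
  simpa [F] using kernelInt_add_three hγ (a := 1) (by simp) y

/-- Substitute `σ = r s` with `r = a ^ (-1/3)`, which normalizes the cubic coefficient to one. -/
lemma kernelInt_scale (γ y : ℂ) {a : ℝ} (ha : 0 < a) :
    kernelInt γ a y = (a : ℂ) ^ (-(γ + 1) / 3) * F γ (y * (a : ℂ) ^ (-1 / 3 : ℂ)) := by
  have hr : (a : ℂ) ^ (-1 / 3 : ℂ) = ((a ^ (-1 / 3 : ℝ) : ℝ) : ℂ) := by
    rw [Complex.ofReal_cpow ha.le]; push_cast; rfl
  set r : ℝ := a ^ (-1 / 3 : ℝ) with hrdef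
  have hr0 : 0 < r := by positivity
  have hr3 : a * r ^ 3 = 1 := by
    rw [hrdef, ← Real.rpow_natCast, ← Real.rpow_mul ha.le]
    norm_num
    rw [Real.rpow_neg_one, mul_inv_cancel₀ ha.ne']
  have hr3' : (a : ℂ) * (r : ℂ) ^ 3 = 1 := by exact_mod_cast hr3
  have hpow : (a : ℂ) ^ (-(γ + 1) / 3) = (r : ℂ) ^ (γ + 1) := by
    rw [hrdef, Complex.ofReal_cpow ha.le, ← Complex.ofReal_cpow ha.le,
      Complex.ofReal_cpow ha.le, ← Complex.cpow_mul]
    · congr 1; push_cast; ring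
    · rw [← Complex.ofReal_log ha.le]
      have : Complex.im ((Real.log a : ℂ) * ((-1 / 3 : ℝ) : ℂ)) = 0 := by
        rw [← Complex.ofReal_mul, Complex.ofReal_im]
      rw [this]; linarith [Real.pi_pos]
    · rw [← Complex.ofReal_log ha.le]
      have : Complex.im ((Real.log a : ℂ) * ((-1 / 3 : ℝ) : ℂ)) = 0 := by
        rw [← Complex.ofReal_mul, Complex.ofReal_im]
      rw [this]; linarith [Real.pi_pos]
  have hsub := integral_comp_mul_left_Ioi' (kernel γ a y) 0 hr0
  rw [mul_zero] at hsub
  have hr1 : (r : ℂ) ≠ 0 := by exact_mod_cast hr0.ne'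
  rw [kernelInt, ← hsub, hr, hpow, F, kernelInt, ← integral_const_mul, ← integral_smul]
  refine setIntegral_congr_fun measurableSet_Ioi fun s (hs : 0 < s) => ?_
  simp only [kernel, Complex.real_smul]
  rw [Complex.ofReal_mul, Complex.mul_cpow_ofReal_nonneg hr0.le hs.le,
    Complex.cpow_add _ _ hr1, Complex.cpow_one]
  have : -(a : ℂ) * (r * s) ^ 3 / 3 + y * (r * s) = -1 * (s : ℂ) ^ 3 / 3 + y * r * s := by
    linear_combination (-(s : ℂ) ^ 3 / 3) * hr3'
  rw [this]; ring

/-- Rotation of the ray of integration. -/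
lemma kernelInt_eq_F {γ a : ℂ} (hγ : -1 < γ.re) (ha : 0 < a.re) (y : ℂ) :
    kernelInt γ a y = a ^ (-(γ + 1) / 3) * F γ (y * a ^ (-1 / 3 : ℂ)) := by
  have hopen : IsOpen {z : ℂ | 0 < z.re} := isOpen_lt continuous_const Complex.continuous_re
  have hslit : ∀ z ∈ {z : ℂ | 0 < z.re}, z ∈ Complex.slitPlane := fun z hz => Or.inl hz
  have hf : AnalyticOnNhd ℂ (fun a => kernelInt γ a y) {z : ℂ | 0 < z.re} :=
    DifferentiableOn.analyticOnNhd (fun z hz =>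
      (differentiableAt_kernelInt_left hγ hz y).differentiableWithinAt) hopen
  have hg : AnalyticOnNhd ℂ (fun a : ℂ => a ^ (-(γ + 1) / 3) * F γ (y * a ^ (-1 / 3 : ℂ)))
      {z : ℂ | 0 < z.re} := by
    refine DifferentiableOn.analyticOnNhd (fun z hz => DifferentiableAt.differentiableWithinAt ?_)
      hopen
    have h1 : ∀ c : ℂ, DifferentiableAt ℂ (fun z : ℂ => z ^ c) z := fun c =>
      differentiableAt_id.cpow_const (hslit z hz)
    exact (h1 _).mul (((hasDerivAt_F hγ _).differentiableAt).comp z ((h1 _).const_mul y))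
  -- Both sides are holomorphic in `a` on the right half-plane and agree on the positive reals,
  -- which accumulate at `1`: the identity theorem replaces a contour deformation.
  refine hf.eqOn_of_preconnected_of_frequently_eq hg (convex_halfSpace_re_gt 0).isPreconnected
    (z₀ := 1) (by simp) ?_ ha
  have ht : Tendsto (fun t : ℝ => ((t : ℝ) : ℂ)) (𝓝[≠] 1) (𝓝[≠] 1) := by
    refine tendsto_nhdsWithin_of_tendsto_nhds_of_eventually_within _ ?_ ?_
    · exact (Complex.continuous_ofReal.tendsto' 1 1 (by simp)).mono_left nhdsWithin_le_nhds
    · filter_upwards [self_mem_nhdsWithin] with t ht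
      simpa using ht
  refine ht.frequently (Eventually.frequently ?_)
  filter_upwards [nhdsWithin_le_nhds (lt_mem_nhds (zero_lt_one' ℝ))] with t ht
  exact kernelInt_scale γ y ht

lemma continuous_F {γ : ℂ} (hγ : -1 < γ.re) : Continuous (F γ) :=
  continuous_iff_continuousAt.2 fun y => (hasDerivAt_F hγ y).continuousAt

/-- Approach the imaginary axis along `a + δ` with `δ → 0+`. For `Re y < 0` the integrals have a
majorant independent of `δ`, and the principal powers are continuous at `a`. -/
lemma kernelInt_eq_F_of_neg {γ a y : ℂ} (hγ : -1 < γ.re) (ha : a.re = 0) (ha0 : a.im ≠ 0)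
    (hy : y.re < 0) :
    kernelInt γ a y = a ^ (-(γ + 1) / 3) * F γ (y * a ^ (-1 / 3 : ℂ)) := by
  have hpath : Tendsto (fun δ : ℝ => a + δ) (𝓝[>] 0) (𝓝 a) := by
    have : Continuous fun δ : ℝ => a + δ := by fun_prop
    exact (this.tendsto' 0 a (by simp)).mono_left nhdsWithin_le_nhds
  have h1 : Tendsto (fun δ : ℝ => kernelInt γ (a + δ) y) (𝓝[>] 0) (𝓝 (kernelInt γ a y)) := by
    refine tendsto_integral_filter_of_dominated_convergence
      (fun σ : ℝ => σ ^ γ.re * Real.exp (y.re * σ))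
      (Eventually.of_forall fun δ => aestronglyMeasurable_kernel γ _ y) ?_
      (integrableOn_rpow_mul_exp_neg hγ hy) ?_
    · filter_upwards [self_mem_nhdsWithin] with δ hδ
      refine (ae_restrict_iff' measurableSet_Ioi).2 (Eventually.of_forall fun σ hσ => ?_)
      refine norm_kernel_le ?_ y hσ
      simpa [ha] using le_of_lt hδ
    · refine Eventually.of_forall fun σ => ?_
      have : Continuous fun a : ℂ => kernel γ a y σ := by unfold kernel; fun_prop
      exact (this.tendsto a).comp hpath
  have hslit : a ∈ Complex.slitPlane := Or.inr ha0
  have h2 : Tendsto (fun δ : ℝ => (a + δ : ℂ) ^ (-(γ + 1) / 3) *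
      F γ (y * (a + δ : ℂ) ^ (-1 / 3 : ℂ))) (𝓝[>] 0)
      (𝓝 (a ^ (-(γ + 1) / 3) * F γ (y * a ^ (-1 / 3 : ℂ)))) := by
    have hc : ∀ c : ℂ, Tendsto (fun δ : ℝ => (a + δ : ℂ) ^ c) (𝓝[>] 0) (𝓝 (a ^ c)) := fun c =>
      (continuousAt_cpow_const hslit).tendsto.comp hpath
    exact (hc _).mul (((continuous_F hγ).tendsto _).comp ((hc _).const_mul y))
  refine tendsto_nhds_unique h1 (h2.congr' ?_)
  filter_upwards [self_mem_nhdsWithin] with δ hδ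
  exact (kernelInt_eq_F hγ (by simpa [ha] using hδ) y).symm

/-! ### Oscillatory integrals as values of `F`. -/

lemma exp_neg_mul_kernel (γ a y : ℂ) (ε σ : ℝ) :
    (Real.exp (-ε * σ) : ℂ) * kernel γ a y σ = kernel γ a (y - ε) σ := by
  rw [kernel, kernel, Complex.ofReal_exp, mul_left_comm, ← Complex.exp_add]
  congr 2; push_cast; ring

/-- The regularizing factor only shifts `y` to `y - ε`, so the limit is continuity of `F γ`. -/
lemma hasOscIntegral_kernel {γ a y : ℂ} (hγ : -1 < γ.re) (ha : a.re = 0) (ha0 : a.im ≠ 0)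
    (hy : y.re = 0) :
    HasOscIntegral (kernel γ a y) (a ^ (-(γ + 1) / 3) * F γ (y * a ^ (-1 / 3 : ℂ))) := by
  simp only [HasOscIntegral, exp_neg_mul_kernel]
  refine ⟨fun ε hε => integrableOn_kernel_of_neg hγ ha.ge (by simpa [hy] using hε), ?_⟩
  have hpath : Tendsto (fun ε : ℝ => y - ε) (𝓝[>] 0) (𝓝 y) := by
    have : Continuous fun δ : ℝ => y - δ := by fun_prop
    exact (this.tendsto' 0 y (by simp)).mono_left nhdsWithin_le_nhds
  have h2 := (((continuous_F hγ).tendsto _).comp (hpath.mul_const (a ^ (-1 / 3 : ℂ)))).const_mul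
    (a ^ (-(γ + 1) / 3))
  refine h2.congr' ?_
  filter_upwards [self_mem_nhdsWithin] with ε hε
  exact (kernelInt_eq_F_of_neg hγ ha ha0 (by simpa [hy] using hε)).symm

lemma HasOscIntegral.add {f g : ℝ → ℂ} {a b : ℂ} (hf : HasOscIntegral f a)
    (hg : HasOscIntegral g b) : HasOscIntegral (fun s => f s + g s) (a + b) := by
  refine ⟨fun ε hε => ?_, ?_⟩
  · simp only [mul_add]
    exact (hf.1 ε hε).add (hg.1 ε hε)
  · refine (hf.2.add hg.2).congr' ?_
    filter_upwards [self_mem_nhdsWithin] with ε hε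
    simp only [mul_add]
    exact (integral_add (hf.1 ε hε) (hg.1 ε hε)).symm

lemma HasOscIntegral.const_mul {f : ℝ → ℂ} {a : ℂ} (hf : HasOscIntegral f a) (c : ℂ) :
    HasOscIntegral (fun s => c * f s) (c * a) := by
  refine ⟨fun ε hε => ?_, ?_⟩
  · simp only [mul_left_comm _ c]
    exact (hf.1 ε hε).const_mul c
  · refine (hf.2.const_mul c).congr fun ε => ?_
    simp only [mul_left_comm _ c]
    exact (integral_const_mul _ _).symm

lemma HasOscIntegral.oscIntegral_eq {f : ℝ → ℂ} {a : ℂ} (hf : HasOscIntegral f a) :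
    oscIntegral f = a := hf.2.limUnder_eq

/-- The primitive third root of unity `exp (2 π i / 3)`. -/
noncomputable def ω : ℂ := Complex.exp (2 * Real.pi * Complex.I / 3)

/-- The phase factor `exp (i π / 6 - i π γ / 3)`. -/
noncomputable def phaseFactor (γ : ℂ) : ℂ :=
  Complex.exp (Complex.I * Real.pi / 6 - Complex.I * Real.pi * γ / 3)

lemma phaseFactor_ne_zero (γ : ℂ) : phaseFactor γ ≠ 0 := Complex.exp_ne_zero _

lemma neg_I_cpow (c : ℂ) : (-Complex.I) ^ c = Complex.exp (-(Real.pi * Complex.I / 2) * c) := by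
  rw [Complex.cpow_def_of_ne_zero (neg_ne_zero.2 Complex.I_ne_zero), Complex.log_neg_I]
  congr 1; ring

lemma I_cpow (c : ℂ) : Complex.I ^ c = Complex.exp ((Real.pi * Complex.I / 2) * c) := by
  rw [Complex.cpow_def_of_ne_zero Complex.I_ne_zero, Complex.log_I]
  congr 1; ring

lemma exp_pi_half_mul_I : Complex.exp (Real.pi * Complex.I / 2) = Complex.I := by
  have := Complex.exp_pi_div_two_mul_I
  rwa [show (Real.pi / 2 : ℂ) * Complex.I = Real.pi * Complex.I / 2 by ring] at this

/-- Take `a = -i`, `y = i x`: the argument is `i (-i) ^ (-1/3) x = ω x`, and `(-i) ^ (-(γ+1)/3)`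
times `exp (-iπγ/2)` is `phaseFactor γ`. -/
lemma hasOscIntegral_exp_phase {γ : ℂ} (hγ : -1 < γ.re) (x : ℝ) :
    HasOscIntegral (fun σ : ℝ => (σ : ℂ) ^ γ * Complex.exp (phase γ x σ * Complex.I))
      (phaseFactor γ * F γ (ω * x)) := by
  have h := (hasOscIntegral_kernel hγ (a := -Complex.I) (y := Complex.I * x) (by simp) (by simp)
    (by simp)).const_mul (Complex.exp (-(γ * Real.pi / 2) * Complex.I))
  convert h using 1
  · ext σ
    rw [kernel, mul_left_comm, ← Complex.exp_add, phase]
    congr 2; ring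
  · rw [← mul_assoc, neg_I_cpow, neg_I_cpow, ← Complex.exp_add, phaseFactor]
    congr 2
    · ring_nf
    · rw [mul_right_comm]
      congr 1
      rw [show Complex.I * Complex.exp (-(Real.pi * Complex.I / 2) * (-1 / 3)) =
        Complex.exp (Real.pi * Complex.I / 2) *
          Complex.exp (-(Real.pi * Complex.I / 2) * (-1 / 3)) by rw [exp_pi_half_mul_I],
        ← Complex.exp_add, ω]
      congr 1; ring

lemma hasOscIntegral_exp_neg_phase {γ : ℂ} (hγ : -1 < γ.re) (x : ℝ) :
    HasOscIntegral (fun σ : ℝ => (σ : ℂ) ^ γ * Complex.exp (-phase γ x σ * Complex.I))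
      ((phaseFactor γ)⁻¹ * F γ (ω ^ 2 * x)) := by
  have h := (hasOscIntegral_kernel hγ (a := Complex.I) (y := -Complex.I * x) (by simp) (by simp)
    (by simp)).const_mul (Complex.exp ((γ * Real.pi / 2) * Complex.I))
  convert h using 1
  · ext σ
    rw [kernel, mul_left_comm, ← Complex.exp_add, phase]
    congr 2; ring
  · rw [← mul_assoc, I_cpow, I_cpow, ← Complex.exp_add, phaseFactor, ← Complex.exp_neg]
    congr 2
    · ring_nf
    · rw [mul_right_comm]
      congr 1
      have : -Complex.I = Complex.exp (Real.pi * Complex.I + Real.pi * Complex.I / 2) := by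
        rw [Complex.exp_add, Complex.exp_pi_mul_I, exp_pi_half_mul_I]; ring
      rw [this, ← Complex.exp_add, ω, ← Complex.exp_nat_mul]
      congr 1; push_cast; ring

/-- The value of the oscillatory integral of `Ai_γ`, on the rotated rays. -/
lemma hasOscIntegral_aiIntegrand {γ : ℂ} (hγ : -1 < γ.re) (x : ℝ) :
    HasOscIntegral (aiIntegrand γ x)
      (2⁻¹ * (phaseFactor γ * F γ (ω * x) + (phaseFactor γ)⁻¹ * F γ (ω ^ 2 * x))) := by
  convert ((hasOscIntegral_exp_phase hγ x).add
    (hasOscIntegral_exp_neg_phase hγ x)).const_mul 2⁻¹ using 1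
  ext σ
  rw [aiIntegrand, Complex.cos]; ring

lemma hasOscIntegral_giIntegrand {γ : ℂ} (hγ : -1 < γ.re) (x : ℝ) :
    HasOscIntegral (giIntegrand γ x)
      (2⁻¹ * Complex.I * (-1 * (phaseFactor γ * F γ (ω * x)) +
        (phaseFactor γ)⁻¹ * F γ (ω ^ 2 * x))) := by
  convert (((hasOscIntegral_exp_phase hγ x).const_mul (-1)).add
    (hasOscIntegral_exp_neg_phase hγ x)).const_mul (2⁻¹ * Complex.I) using 1
  ext σ
  rw [giIntegrand, Complex.sin]; ring

lemma Ai_eq {γ : ℂ} (hγ : -1 < γ.re) (x : ℝ) :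
    Ai γ x = 1 / Real.pi *
      (2⁻¹ * (phaseFactor γ * F γ (ω * x) + (phaseFactor γ)⁻¹ * F γ (ω ^ 2 * x))) := by
  rw [Ai, (hasOscIntegral_aiIntegrand hγ x).oscIntegral_eq]

lemma Gi_eq {γ : ℂ} (hγ : -1 < γ.re) (x : ℝ) :
    Gi γ x = 1 / Real.pi * (2⁻¹ * Complex.I * (-1 * (phaseFactor γ * F γ (ω * x)) +
        (phaseFactor γ)⁻¹ * F γ (ω ^ 2 * x))) := by
  rw [Gi, (hasOscIntegral_giIntegrand hγ x).oscIntegral_eq]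

lemma hiIntegrand_eq_kernel (γ : ℂ) (x : ℝ) : hiIntegrand γ x = kernel γ 1 x := by
  ext σ; rw [hiIntegrand, kernel]; congr 2; ring

lemma Hi_eq (γ : ℂ) (x : ℝ) : Hi γ x = 1 / Real.pi * F γ x := by
  rw [Hi, F, kernelInt, hiIntegrand_eq_kernel]

/-! ### Convergence as improper integrals. -/

/-- The Abelian theorem for integrals: a convergent improper integral is the limit of its
exponentially regularized integrals. -/
lemma tendsto_integral_exp_neg_mul {f : ℝ → ℂ} {L : ℂ} (hcont : ContinuousOn f (Ioi 0))
    (hint : ∀ a b, IntervalIntegrable f volume a b)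
    (hf : ∀ ε : ℝ, 0 < ε → IntegrableOn (fun σ : ℝ => (Real.exp (-ε * σ) : ℂ) * f σ) (Ioi 0))
    (hL : Tendsto (fun R : ℝ => ∫ σ in (0 : ℝ)..R, f σ) atTop (𝓝 L)) :
    Tendsto (fun ε : ℝ => ∫ σ in Ioi (0 : ℝ), (Real.exp (-ε * σ) : ℂ) * f σ) (𝓝[>] 0)
      (𝓝 L) := by
  set S : ℝ → ℂ := fun R => ∫ σ in (0 : ℝ)..R, f σ with hS
  have hScont : Continuous S := intervalIntegral.continuous_primitive hint 0
  obtain ⟨C, hC⟩ : ∃ C, ∀ R ∈ Ici (0 : ℝ), ‖S R‖ ≤ C := by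
    obtain ⟨N, hN⟩ := eventually_atTop.1 (hL.norm.eventually_le_const (lt_add_one ‖L‖))
    obtain ⟨B, hB⟩ := (isCompact_Icc (a := (0 : ℝ)) (b := N)).exists_bound_of_continuousOn
      hScont.continuousOn
    refine ⟨max B (‖L‖ + 1), fun R hR => ?_⟩
    rcases le_total R N with h | h
    · exact (hB R ⟨hR, h⟩).trans (le_max_left _ _)
    · exact (hN R h).trans (le_max_right _ _)
  have hexp : ∀ ε : ℝ, 0 < ε → IntegrableOn (fun σ : ℝ => Real.exp (-ε * σ)) (Ioi 0) :=
    fun ε hε => integrableOn_exp_mul_Ioi (by linarith) 0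
  have hSint : ∀ ε : ℝ, 0 < ε →
      IntegrableOn (fun σ : ℝ => (Real.exp (-ε * σ) : ℂ) * S σ) (Ioi 0) := by
    intro ε hε
    refine Integrable.mono' ((hexp ε hε).mul_const C)
      (by fun_prop : Continuous fun σ : ℝ => (Real.exp (-ε * σ) : ℂ) * S σ).aestronglyMeasurable ?_
    refine (ae_restrict_iff' measurableSet_Ioi).2 (Eventually.of_forall fun σ hσ => ?_)
    rw [norm_mul, Complex.norm_real, Real.norm_of_nonneg (Real.exp_pos _).le]
    exact mul_le_mul_of_nonneg_left (hC σ (Ioi_subset_Ici_self hσ)) (Real.exp_pos _).le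
  -- Integrate by parts against the primitive `S`, then rescale `t = ε σ`. Now `S (t / ε) → L` for
  -- each `t > 0`, with the uniform bound `C`, so dominated convergence applies.
  have hparts : ∀ ε : ℝ, 0 < ε → ∫ σ in Ioi (0 : ℝ), (Real.exp (-ε * σ) : ℂ) * f σ =
      ∫ t in Ioi (0 : ℝ), (Real.exp (-t) : ℂ) * S (ε⁻¹ * t) := by
    intro ε hε
    have hd : ∀ σ ∈ Ioi (0 : ℝ), HasDerivAt (fun σ : ℝ => (Real.exp (-ε * σ) : ℂ) * S σ)
        ((Real.exp (-ε * σ) : ℂ) * f σ - ε * ((Real.exp (-ε * σ) : ℂ) * S σ)) σ := by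
      intro σ hσ
      have h1 : HasDerivAt S (f σ) σ :=
        intervalIntegral.integral_hasDerivAt_right (hint 0 σ)
          (hcont.stronglyMeasurableAtFilter isOpen_Ioi σ hσ)
          (hcont.continuousAt (Ioi_mem_nhds hσ))
      have h2 : HasDerivAt (fun σ : ℝ => Real.exp (-ε * σ)) (Real.exp (-ε * σ) * -ε) σ := by
        simpa using ((hasDerivAt_id σ).const_mul (-ε)).exp
      refine (h2.ofReal_comp.mul h1).congr_deriv ?_
      push_cast; ring
    have htop : Tendsto (fun σ : ℝ => (Real.exp (-ε * σ) : ℂ) * S σ) atTop (𝓝 0) := by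
      have h1 : Tendsto (fun σ : ℝ => Real.exp (-ε * σ)) atTop (𝓝 0) := by
        refine Real.tendsto_exp_atBot.comp ?_
        exact tendsto_id.const_mul_atTop_of_neg (by linarith)
      have h2 : Tendsto (fun σ : ℝ => (Real.exp (-ε * σ) : ℂ)) atTop (𝓝 0) := by
        rw [← Complex.ofReal_zero]
        exact (Complex.continuous_ofReal.tendsto 0).comp h1
      simpa using h2.mul hL
    have key := integral_Ioi_of_hasDerivAt_of_tendsto
      (by fun_prop : Continuous fun σ : ℝ =>
        (Real.exp (-ε * σ) : ℂ) * S σ).continuousWithinAt hd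
      ((hf ε hε).sub ((hSint ε hε).const_mul _)) htop
    have hS0 : S 0 = 0 := intervalIntegral.integral_same
    rw [integral_sub (hf ε hε) ((hSint ε hε).const_mul _), integral_const_mul, hS0, mul_zero,
      sub_zero, sub_eq_zero] at key
    rw [key]
    have hsub := integral_comp_mul_left_Ioi'
      (fun t : ℝ => (Real.exp (-t) : ℂ) * S (ε⁻¹ * t)) 0 hε
    rw [mul_zero] at hsub
    rw [← hsub, Complex.real_smul]
    congr 1
    refine setIntegral_congr_fun measurableSet_Ioi fun s _ => ?_
    simp only [inv_mul_cancel_left₀ hε.ne', neg_mul]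
  have hlim : Tendsto (fun ε : ℝ => ∫ t in Ioi (0 : ℝ), (Real.exp (-t) : ℂ) * S (ε⁻¹ * t)) (𝓝[>] 0)
      (𝓝 (∫ t in Ioi (0 : ℝ), (Real.exp (-t) : ℂ) * L)) := by
    refine tendsto_integral_filter_of_dominated_convergence
      (fun t : ℝ => Real.exp (-1 * t) * C) (Eventually.of_forall fun ε => ?_) ?_
      ((hexp 1 one_pos).mul_const C) ?_
    · exact (by fun_prop : Continuous fun t : ℝ =>
        (Real.exp (-t) : ℂ) * S (ε⁻¹ * t)).aestronglyMeasurable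
    · filter_upwards [self_mem_nhdsWithin] with ε hε
      have hε : 0 < ε := hε
      refine (ae_restrict_iff' measurableSet_Ioi).2 (Eventually.of_forall fun t ht => ?_)
      have ht : 0 < t := ht
      rw [norm_mul, Complex.norm_real, Real.norm_of_nonneg (Real.exp_pos _).le, neg_one_mul]
      exact mul_le_mul_of_nonneg_left (hC _ (by simp only [mem_Ici]; positivity))
        (Real.exp_pos _).le
    · refine (ae_restrict_iff' measurableSet_Ioi).2 (Eventually.of_forall fun t ht => ?_)
      exact (hL.comp (tendsto_inv_nhdsGT_zero.atTop_mul_const ht)).const_mul _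
  have hval : ∫ t in Ioi (0 : ℝ), (Real.exp (-t) : ℂ) * L = L := by
    rw [integral_mul_const, integral_complex_ofReal, integral_exp_neg_Ioi_zero]
    simp
  rw [hval] at hlim
  refine hlim.congr' ?_
  filter_upwards [self_mem_nhdsWithin] with ε hε using (hparts ε hε).symm

/-- Only the existence of some limit `L` has to be proved; the Abelian theorem forces `L = A`. -/
lemma HasOscIntegral.tendsto_intervalIntegral {f : ℝ → ℂ} {A L : ℂ} (h : HasOscIntegral f A)
    (hcont : ContinuousOn f (Ioi 0)) (hint : ∀ a b, IntervalIntegrable f volume a b)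
    (hL : Tendsto (fun R : ℝ => ∫ σ in (0 : ℝ)..R, f σ) atTop (𝓝 L)) :
    Tendsto (fun R : ℝ => ∫ σ in (0 : ℝ)..R, f σ) atTop (𝓝 A) := by
  rwa [tendsto_nhds_unique h.2 (tendsto_integral_exp_neg_mul hcont hint h.1 hL)]

lemma norm_kernel_of_re_eq_zero {γ a y : ℂ} (ha : a.re = 0) (hy : y.re = 0) {σ : ℝ} (hσ : 0 < σ) :
    ‖kernel γ a y σ‖ = σ ^ γ.re := by
  rw [norm_kernel _ _ _ hσ]; simp [ha, hy]

lemma intervalIntegrable_kernel_of_pos (γ a y : ℂ) {c d : ℝ} (hc : 0 < c) (hd : 0 < d) :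
    IntervalIntegrable (kernel γ a y) volume c d := by
  refine ((continuousOn_kernel γ a y).mono fun s hs => ?_).intervalIntegrable
  exact (lt_min hc hd).trans_le hs.1

lemma intervalIntegrable_kernel {γ : ℂ} (hγ : -1 < γ.re) (a y : ℂ) (c d : ℝ) :
    IntervalIntegrable (kernel γ a y) volume c d :=
  (intervalIntegral.intervalIntegrable_cpow' hγ).mul_continuousOn (by fun_prop)

lemma exists_tendsto_integral_kernel_of_lt_neg_one {γ a y : ℂ} (ha : a.re = 0) (hy : y.re = 0)
    (hγ : γ.re < -1) :
    ∃ L, Tendsto (fun R : ℝ => ∫ σ in (1 : ℝ)..R, kernel γ a y σ) atTop (𝓝 L) := by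
  refine ⟨_, intervalIntegral_tendsto_integral_Ioi 1 ?_ tendsto_id⟩
  refine Integrable.mono' (integrableOn_Ioi_rpow_of_lt hγ one_pos)
    (((continuousOn_kernel γ a y).mono (Ioi_subset_Ioi zero_le_one)).aestronglyMeasurable
      measurableSet_Ioi) ?_
  refine (ae_restrict_iff' measurableSet_Ioi).2 (Eventually.of_forall fun σ hσ => ?_)
  exact (norm_kernel_of_re_eq_zero ha hy (one_pos.trans hσ)).le

/-- Integrate the derivative of `kernel (γ - 2) a y` and solve for the `kernel γ` term. The boundary
term decays exactly because `Re γ < 2`, and the term in `γ - 3` converges absolutely. The integrals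
start at `1` since the lowered exponents may be too singular at `0`. -/
lemma exists_tendsto_integral_kernel_step {γ a y : ℂ} (ha : a.re = 0) (ha0 : a ≠ 0)
    (hy : y.re = 0) (hγ : γ.re < 2)
    (h : ∃ L, Tendsto (fun R : ℝ => ∫ σ in (1 : ℝ)..R, kernel (γ - 2) a y σ) atTop (𝓝 L)) :
    ∃ L, Tendsto (fun R : ℝ => ∫ σ in (1 : ℝ)..R, kernel γ a y σ) atTop (𝓝 L) := by
  obtain ⟨L₁, h₁⟩ := h
  obtain ⟨L₂, h₂⟩ := exists_tendsto_integral_kernel_of_lt_neg_one (γ := γ - 3) (a := a) (y := y)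
    ha hy (by simp; linarith)
  have h0 : Tendsto (kernel (γ - 2) a y) atTop (𝓝 0) := by
    refine squeeze_zero_norm' (a := fun σ : ℝ => σ ^ (-(2 - γ.re))) ?_
      (tendsto_rpow_neg_atTop (by linarith))
    filter_upwards [eventually_gt_atTop 0] with σ hσ
    rw [norm_kernel_of_re_eq_zero ha hy hσ]
    simp
  refine ⟨a⁻¹ * ((γ - 2) * L₂ + y * L₁ - (0 - kernel (γ - 2) a y 1)),
    ((((h₂.const_mul (γ - 2)).add (h₁.const_mul y)).sub (h0.sub_const _)).const_mul
      a⁻¹).congr' ?_⟩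
  filter_upwards [eventually_gt_atTop 0] with R hR
  have hi : ∀ β, IntervalIntegrable (kernel β a y) volume 1 R := fun β =>
    intervalIntegrable_kernel_of_pos β a y one_pos hR
  have hd : ∀ σ ∈ uIcc 1 R, HasDerivAt (kernel (γ - 2) a y)
      ((γ - 2) * kernel (γ - 3) a y σ - a * kernel γ a y σ + y * kernel (γ - 2) a y σ) σ := by
    intro σ hσ
    have := hasDerivAt_kernel (γ - 3) a y (σ := σ) ((lt_min one_pos hR).trans_le hσ.1)
    rwa [show γ - 3 + 1 = γ - 2 by ring, show γ - 3 + 3 = γ by ring] at this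
  have key := intervalIntegral.integral_eq_sub_of_hasDerivAt hd
    ((((hi _).const_mul _).sub ((hi _).const_mul _)).add ((hi _).const_mul _))
  rw [intervalIntegral.integral_add (((hi _).const_mul _).sub ((hi _).const_mul _))
    ((hi _).const_mul _), intervalIntegral.integral_sub ((hi _).const_mul _) ((hi _).const_mul _),
    intervalIntegral.integral_const_mul, intervalIntegral.integral_const_mul,
    intervalIntegral.integral_const_mul] at key
  rw [← key]
  field_simp
  ring

lemma exists_tendsto_integral_kernel {γ a y : ℂ} (hγ : -1 < γ.re) (ha : a.re = 0) (ha0 : a ≠ 0)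
    (hy : y.re = 0) (hγ2 : γ.re < 2) :
    ∃ L, Tendsto (fun R : ℝ => ∫ σ in (0 : ℝ)..R, kernel γ a y σ) atTop (𝓝 L) := by
  -- One step goes from absolute convergence (`Re < -1`) to `Re β < 1`; a second one reaches `Re γ <
  -- 2`.
  have hstep : ∀ β : ℂ, β.re < 1 →
      ∃ L, Tendsto (fun R : ℝ => ∫ σ in (1 : ℝ)..R, kernel β a y σ) atTop (𝓝 L) := fun β hβ =>
    exists_tendsto_integral_kernel_step ha ha0 hy (by linarith)
      (exists_tendsto_integral_kernel_of_lt_neg_one ha hy (by simp; linarith))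
  obtain ⟨L, hL⟩ := exists_tendsto_integral_kernel_step ha ha0 hy hγ2
    (hstep (γ - 2) (by simp; linarith))
  refine ⟨(∫ σ in (0 : ℝ)..1, kernel γ a y σ) + L, (hL.const_add _).congr fun R => ?_⟩
  exact intervalIntegral.integral_add_adjacent_intervals (intervalIntegrable_kernel hγ a y _ _)
    (intervalIntegrable_kernel hγ a y _ _)

lemma tendsto_integral_kernel_comb {γ a b y z c d A : ℂ} (hγ : -1 < γ.re) (hγ2 : γ.re < 2)
    (ha : a.re = 0) (ha0 : a ≠ 0) (hy : y.re = 0) (hb : b.re = 0) (hb0 : b ≠ 0) (hz : z.re = 0)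
    (h : HasOscIntegral (fun σ => c * kernel γ a y σ + d * kernel γ b z σ) A) :
    Tendsto (fun R : ℝ => ∫ σ in (0 : ℝ)..R, (c * kernel γ a y σ + d * kernel γ b z σ)) atTop
      (𝓝 A) := by
  obtain ⟨L, hL⟩ := exists_tendsto_integral_kernel hγ ha ha0 hy hγ2
  obtain ⟨M, hM⟩ := exists_tendsto_integral_kernel hγ hb hb0 hz hγ2
  have i1 : ∀ s t, IntervalIntegrable (fun σ => c * kernel γ a y σ) volume s t := fun s t =>
    (intervalIntegrable_kernel hγ a y s t).const_mul c
  have i2 : ∀ s t, IntervalIntegrable (fun σ => d * kernel γ b z σ) volume s t := fun s t =>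
    (intervalIntegrable_kernel hγ b z s t).const_mul d
  refine h.tendsto_intervalIntegral (L := c * L + d * M) ?_ (fun s t => (i1 s t).add (i2 s t)) ?_
  · exact ((continuousOn_kernel γ a y).const_smul c).add ((continuousOn_kernel γ b z).const_smul d)
  · refine ((hL.const_mul c).add (hM.const_mul d)).congr fun R => ?_
    rw [intervalIntegral.integral_add (i1 0 R) (i2 0 R), intervalIntegral.integral_const_mul,
      intervalIntegral.integral_const_mul]

lemma aiIntegrand_eq_kernel (γ : ℂ) (x : ℝ) : aiIntegrand γ x = fun σ =>
    (2⁻¹ * Complex.exp (-(γ * Real.pi / 2) * Complex.I)) *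
      kernel γ (-Complex.I) (Complex.I * x) σ +
    (2⁻¹ * Complex.exp ((γ * Real.pi / 2) * Complex.I)) *
      kernel γ Complex.I (-Complex.I * x) σ := by
  ext σ
  have h1 : Complex.exp (phase γ x σ * Complex.I) =
      Complex.exp (-(γ * Real.pi / 2) * Complex.I) *
        Complex.exp (-(-Complex.I) * (σ : ℂ) ^ 3 / 3 + Complex.I * x * σ) := by
    rw [← Complex.exp_add, phase]; congr 1; ring
  have h2 : Complex.exp (-phase γ x σ * Complex.I) =
      Complex.exp ((γ * Real.pi / 2) * Complex.I) *
        Complex.exp (-Complex.I * (σ : ℂ) ^ 3 / 3 + -Complex.I * x * σ) := by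
    rw [← Complex.exp_add, phase]; congr 1; ring
  rw [aiIntegrand, Complex.cos, h1, h2, kernel, kernel]
  ring

lemma giIntegrand_eq_kernel (γ : ℂ) (x : ℝ) : giIntegrand γ x = fun σ =>
    (-2⁻¹ * Complex.I * Complex.exp (-(γ * Real.pi / 2) * Complex.I)) *
      kernel γ (-Complex.I) (Complex.I * x) σ +
    (2⁻¹ * Complex.I * Complex.exp ((γ * Real.pi / 2) * Complex.I)) *
      kernel γ Complex.I (-Complex.I * x) σ := by
  ext σ
  have h1 : Complex.exp (phase γ x σ * Complex.I) =
      Complex.exp (-(γ * Real.pi / 2) * Complex.I) *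
        Complex.exp (-(-Complex.I) * (σ : ℂ) ^ 3 / 3 + Complex.I * x * σ) := by
    rw [← Complex.exp_add, phase]; congr 1; ring
  have h2 : Complex.exp (-phase γ x σ * Complex.I) =
      Complex.exp ((γ * Real.pi / 2) * Complex.I) *
        Complex.exp (-Complex.I * (σ : ℂ) ^ 3 / 3 + -Complex.I * x * σ) := by
    rw [← Complex.exp_add, phase]; congr 1; ring
  rw [giIntegrand, Complex.sin, h1, h2, kernel, kernel]
  ring

lemma tendsto_integral_aiIntegrand {γ A : ℂ} (hγ : -1 < γ.re) (hγ2 : γ.re < 2) {x : ℝ}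
    (h : HasOscIntegral (aiIntegrand γ x) A) :
    Tendsto (fun R : ℝ => ∫ σ in (0 : ℝ)..R, aiIntegrand γ x σ) atTop (𝓝 A) := by
  rw [aiIntegrand_eq_kernel] at h ⊢
  exact tendsto_integral_kernel_comb hγ hγ2 (by simp) (by simp) (by simp) (by simp) (by simp)
    (by simp) h

lemma tendsto_integral_giIntegrand {γ A : ℂ} (hγ : -1 < γ.re) (hγ2 : γ.re < 2) {x : ℝ}
    (h : HasOscIntegral (giIntegrand γ x) A) :
    Tendsto (fun R : ℝ => ∫ σ in (0 : ℝ)..R, giIntegrand γ x σ) atTop (𝓝 A) := by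
  rw [giIntegrand_eq_kernel] at h ⊢
  exact tendsto_integral_kernel_comb hγ hγ2 (by simp) (by simp) (by simp) (by simp) (by simp)
    (by simp) h

/-! ### Gamma triplication and the moments at zero. -/

/-- Group the factors by the residue of `j` modulo 3. -/
lemma prod_range_three_mul (z : ℂ) (N : ℕ) :
    ∏ j ∈ Finset.range (3 * N), (3 * z + j) = 3 ^ (3 * N) *
      ((∏ j ∈ Finset.range N, (z + j)) * (∏ j ∈ Finset.range N, (z + 1 / 3 + j)) *
        ∏ j ∈ Finset.range N, (z + 2 / 3 + j)) := by
  induction N with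
  | zero => simp
  | succ N ih =>
    rw [show 3 * (N + 1) = 3 * N + 1 + 1 + 1 by ring, Finset.prod_range_succ,
      Finset.prod_range_succ, Finset.prod_range_succ, ih]
    simp only [Finset.prod_range_succ]
    push_cast
    ring

/-- The ratio of the Euler sequences in the triplication formula at `z = 0`. -/
noncomputable def triplicationSeq (n : ℕ) : ℂ :=
  n * (n.factorial : ℂ) ^ 3 * 3 ^ (3 * n + 3) / (3 * n + 2).factorial

/-- The Euler sequence of index `n` has `n + 1` factors in its denominator, so three of them match
index `3 n + 2`. Apart from the explicit power, the ratio does not depend on `z`. -/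
lemma GammaSeq_triplication (z : ℂ) {n : ℕ} (hn : n ≠ 0) :
    Complex.GammaSeq z n * Complex.GammaSeq (z + 1 / 3) n * Complex.GammaSeq (z + 2 / 3) n =
      Complex.GammaSeq (3 * z) (3 * n + 2) * (((n : ℝ) / (3 * n + 2) : ℝ) : ℂ) ^ (3 * z) *
        triplicationSeq n := by
  have hn0 : (n : ℂ) ≠ 0 := by exact_mod_cast hn
  have h1 : (n : ℂ) ^ z * (n : ℂ) ^ (z + 1 / 3) * (n : ℂ) ^ (z + 2 / 3) =
      (n : ℂ) ^ (3 * z) * n := by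
    rw [← Complex.cpow_add _ _ hn0, ← Complex.cpow_add _ _ hn0]
    nth_rewrite 3 [← Complex.cpow_one (n : ℂ)]
    rw [← Complex.cpow_add _ _ hn0]
    congr 1; ring
  have h2 : (n : ℂ) ^ (3 * z) = ((3 * n + 2 : ℕ) : ℂ) ^ (3 * z) *
      (((n : ℝ) / (3 * n + 2) : ℝ) : ℂ) ^ (3 * z) := by
    rw [← Complex.ofReal_natCast (3 * n + 2), ← Complex.mul_cpow_ofReal_nonneg
      (by positivity) (by positivity)]
    congr 1
    have : (3 * n + 2 : ℂ) ≠ 0 := by exact_mod_cast (by omega : 3 * n + 2 ≠ 0)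
    push_cast
    rw [mul_comm, div_mul_cancel₀ _ this]
  have h3 := prod_range_three_mul z (n + 1)
  have hf : ((3 * n + 2).factorial : ℂ) ≠ 0 := by exact_mod_cast Nat.factorial_ne_zero _
  simp only [Complex.GammaSeq, triplicationSeq]
  rw [show 3 * n + 2 + 1 = 3 * (n + 1) by ring, h3,
    div_mul_div_comm, div_mul_div_comm,
    show (n : ℂ) ^ z * n.factorial * ((n : ℂ) ^ (z + 1 / 3) * n.factorial) *
      ((n : ℂ) ^ (z + 2 / 3) * n.factorial) =
      ((n : ℂ) ^ z * (n : ℂ) ^ (z + 1 / 3) * (n : ℂ) ^ (z + 2 / 3)) * (n.factorial : ℂ) ^ 3 by ring,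
    h1, h2]
  generalize (∏ j ∈ Finset.range (n + 1), (z + j)) * (∏ j ∈ Finset.range (n + 1), (z + 1 / 3 + j)) *
    ∏ j ∈ Finset.range (n + 1), (z + 2 / 3 + j) = D
  generalize (((n : ℝ) / (3 * n + 2) : ℝ) : ℂ) ^ (3 * z) = W
  have h3p : (3 : ℂ) ^ (3 * (n + 1)) ≠ 0 := pow_ne_zero _ three_ne_zero
  by_cases hD : D = 0
  · simp [hD]
  · field_simp

lemma tendsto_natCast_div_three_mul_add_two :
    Tendsto (fun n : ℕ => (((n : ℝ) / (3 * n + 2) : ℝ) : ℂ)) atTop (𝓝 ((1 / 3 : ℝ) : ℂ)) := by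
  refine (Complex.continuous_ofReal.tendsto _).comp ?_
  have h : Tendsto (fun n : ℕ => (1 : ℝ) / (3 + 2 / (n : ℝ))) atTop (𝓝 (1 / (3 + 0))) :=
    tendsto_const_nhds.div (tendsto_const_nhds.add (tendsto_const_div_atTop_nhds_zero_nat 2))
      (by norm_num)
  rw [add_zero] at h
  refine h.congr' ?_
  filter_upwards [eventually_ne_atTop 0] with n hn
  have : (n : ℝ) ≠ 0 := by exact_mod_cast hn
  field_simp

lemma tendsto_triplication (z : ℂ) :
    Tendsto (fun n : ℕ => Complex.GammaSeq (3 * z) (3 * n + 2) *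
      (((n : ℝ) / (3 * n + 2) : ℝ) : ℂ) ^ (3 * z)) atTop
      (𝓝 (Complex.Gamma (3 * z) * (1 / 3) ^ (3 * z))) := by
  have h1 : Tendsto (fun n : ℕ => 3 * n + 2) atTop atTop :=
    tendsto_atTop_mono (fun n => by simp only [id]; omega) tendsto_id
  have h2 : ContinuousAt (fun w : ℂ => w ^ (3 * z)) ((1 / 3 : ℝ) : ℂ) :=
    continuousAt_cpow_const (Complex.ofReal_mem_slitPlane.2 (by norm_num))
  rw [show (1 / 3 : ℂ) = ((1 / 3 : ℝ) : ℂ) by push_cast; rfl]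
  exact ((Complex.GammaSeq_tendsto_Gamma (3 * z)).comp h1).mul
    (h2.tendsto.comp tendsto_natCast_div_three_mul_add_two)

lemma tendsto_GammaSeq_triplication (z : ℂ) :
    Tendsto (fun n : ℕ => Complex.GammaSeq (3 * z) (3 * n + 2) *
      (((n : ℝ) / (3 * n + 2) : ℝ) : ℂ) ^ (3 * z) * triplicationSeq n) atTop
      (𝓝 (Complex.Gamma z * Complex.Gamma (z + 1 / 3) * Complex.Gamma (z + 2 / 3))) := by
  refine (((Complex.GammaSeq_tendsto_Gamma z).mul (Complex.GammaSeq_tendsto_Gamma _)).mul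
    (Complex.GammaSeq_tendsto_Gamma _)).congr' ?_
  filter_upwards [eventually_ne_atTop 0] with n hn using GammaSeq_triplication z hn

lemma Gamma_third_mul_Gamma_two_thirds :
    Complex.Gamma (1 / 3) * Complex.Gamma (2 / 3) = 2 * Real.pi / (√3 : ℝ) := by
  have h := Complex.Gamma_mul_Gamma_one_sub (1 / 3)
  rw [show (1 - 1 / 3 : ℂ) = 2 / 3 by norm_num] at h
  rw [h, show (Real.pi : ℂ) * (1 / 3) = ((Real.pi / 3 : ℝ) : ℂ) by push_cast; ring,
    ← Complex.ofReal_sin, Real.sin_pi_div_three]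
  have : ((√3 : ℝ) : ℂ) ≠ 0 := by simp
  push_cast
  field_simp

lemma tendsto_triplicationSeq :
    Tendsto triplicationSeq atTop (𝓝 (3 * (2 * Real.pi / (√3 : ℝ)))) := by
  -- The constant is independent of `z`, so `z = 1/3` determines it: there the two Gamma values at
  -- `1` are trivial and the reflection formula gives the rest.
  have h1 := tendsto_triplication (1 / 3)
  have h2 := tendsto_GammaSeq_triplication (1 / 3)
  norm_num at h1 h2
  have h3 := h2.div h1 (by norm_num)
  rw [Gamma_third_mul_Gamma_two_thirds] at h3
  rw [show 3 * (2 * (Real.pi : ℂ) / (√3 : ℝ)) = 2 * (Real.pi : ℂ) / (√3 : ℝ) / (1 / 3) by ring]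
  refine h3.congr' ?_
  filter_upwards [h1.eventually_ne (by norm_num : (1 / 3 : ℂ) ≠ 0)] with n hn
  exact mul_div_cancel_left₀ _ hn

/-- The triplication formula for the Gamma function. -/
lemma Gamma_triplication (z : ℂ) :
    Complex.Gamma z * Complex.Gamma (z + 1 / 3) * Complex.Gamma (z + 2 / 3) =
      Complex.Gamma (3 * z) * (1 / 3) ^ (3 * z) * (3 * (2 * Real.pi / (√3 : ℝ))) :=
  tendsto_nhds_unique (tendsto_GammaSeq_triplication z)
    ((tendsto_triplication z).mul tendsto_triplicationSeq)

/-- The moments of `σ ^ γ exp (-σ³/3)`. -/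
lemma F_zero {γ : ℂ} (hγ : -1 < γ.re) :
    F γ 0 = 3 ^ ((γ + 1) / 3 - 1) * Complex.Gamma ((γ + 1) / 3) := by
  have ha : 0 < ((γ + 1) / 3 : ℂ).re := by
    rw [show ((γ + 1) / 3 : ℂ) = ((1 / 3 : ℝ) : ℂ) * (γ + 1) by push_cast; ring,
      Complex.re_ofReal_mul]
    simp; linarith
  have h1 := Complex.integral_cpow_mul_exp_neg_mul_Ioi ha (r := 1 / 3) (by norm_num)
  -- The substitution `t = s³` turns the moment into a Gamma integral with rate `1/3`.
  have h2 := integral_comp_rpow_Ioi_of_pos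
    (g := fun t : ℝ => (t : ℂ) ^ ((γ + 1) / 3 - 1) * Complex.exp (-((1 / 3 : ℝ) * t)))
    (p := 3) (by norm_num)
  rw [h1] at h2
  have h3 : ∀ s ∈ Ioi (0 : ℝ), ((3 : ℝ) * s ^ ((3 : ℝ) - 1)) •
      ((((s ^ (3 : ℝ) : ℝ) : ℂ)) ^ ((γ + 1) / 3 - 1) *
        Complex.exp (-((1 / 3 : ℝ) * (s ^ (3 : ℝ) : ℝ)))) = 3 * kernel γ 1 0 s := by
    intro s hs
    have hs : 0 < s := hs
    have hs0 : (s : ℂ) ≠ 0 := by exact_mod_cast hs.ne'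
    have e1 : s ^ ((3 : ℝ) - 1) = s ^ 2 := by
      rw [← Real.rpow_natCast]; norm_num
    have e2 : s ^ (3 : ℝ) = s ^ 3 := by exact_mod_cast Real.rpow_natCast s 3
    have e3 : ((s ^ 3 : ℝ) : ℂ) ^ ((γ + 1) / 3 - 1) = (s : ℂ) ^ (γ - 2) := by
      rw [Complex.ofReal_pow, ← Complex.ofReal_pow, pow_succ, pow_two, Complex.ofReal_mul,
        Complex.mul_cpow_ofReal_nonneg (by positivity) hs.le, Complex.ofReal_mul,
        Complex.mul_cpow_ofReal_nonneg hs.le hs.le, ← Complex.cpow_add _ _ hs0,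
        ← Complex.cpow_add _ _ hs0]
      congr 1; ring
    have e4 : (s : ℂ) ^ γ = (s : ℂ) ^ (γ - 2) * (s : ℂ) ^ 2 := by
      rw [← Complex.cpow_natCast, ← Complex.cpow_add _ _ hs0]
      congr 1; push_cast; ring
    rw [e1, e2, e3, kernel, e4, Complex.real_smul]
    push_cast
    rw [show -(1 / 3 * (s : ℂ) ^ 3) = -1 * (s : ℂ) ^ 3 / 3 + 0 * s by ring]
    ring
  rw [setIntegral_congr_fun measurableSet_Ioi h3, integral_const_mul] at h2
  have h4 : (1 / ((1 / 3 : ℝ) : ℂ)) = 3 := by push_cast; norm_num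
  rw [h4] at h2
  rw [F, kernelInt, Complex.cpow_sub _ _ three_ne_zero, Complex.cpow_one]
  linear_combination h2 / 3

/-! ### Jets of solutions, Wronskians and brackets. -/

/-- `u` solves `(1 + γ) u + x u' - u''' = 0`, with derivatives `u₁ = u'` and `u₂ = u''`. -/
structure SolutionJet (γ : ℂ) (u u₁ u₂ : ℝ → ℂ) : Prop where
  hasDerivAt₀ : ∀ x, HasDerivAt u (u₁ x) x
  hasDerivAt₁ : ∀ x, HasDerivAt u₁ (u₂ x) x
  hasDerivAt₂ : ∀ x, HasDerivAt u₂ ((1 + γ) * u x + (x : ℂ) * u₁ x) x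

namespace SolutionJet

variable {γ : ℂ} {u u₁ u₂ : ℝ → ℂ}

lemma deriv_eq (h : SolutionJet γ u u₁ u₂) : deriv u = u₁ := funext fun x => (h.hasDerivAt₀ x).deriv

lemma deriv_eq' (h : SolutionJet γ u u₁ u₂) : deriv u₁ = u₂ :=
  funext fun x => (h.hasDerivAt₁ x).deriv

lemma iteratedDeriv_one (h : SolutionJet γ u u₁ u₂) : iteratedDeriv 1 u = u₁ := by
  rw [_root_.iteratedDeriv_one, h.deriv_eq]

lemma iteratedDeriv_two (h : SolutionJet γ u u₁ u₂) : iteratedDeriv 2 u = u₂ := by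
  rw [iteratedDeriv_succ, h.iteratedDeriv_one, h.deriv_eq']

lemma isSolution (h : SolutionJet γ u u₁ u₂) : IsSolution γ u := by
  have hd : deriv u₂ = fun x => (1 + γ) * u x + (x : ℂ) * u₁ x :=
    funext fun x => (h.hasDerivAt₂ x).deriv
  have c0 : Continuous u := continuous_iff_continuousAt.2 fun x => (h.hasDerivAt₀ x).continuousAt
  have c1 : Continuous u₁ := continuous_iff_continuousAt.2 fun x => (h.hasDerivAt₁ x).continuousAt
  refine ⟨?_, fun x => ?_⟩
  · have e2 : ContDiff ℝ 1 u₂ := contDiff_one_iff_deriv.2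
      ⟨fun x => (h.hasDerivAt₂ x).differentiableAt, by rw [hd]; fun_prop⟩
    have e1 : ContDiff ℝ (1 + 1) u₁ := contDiff_succ_iff_deriv.2
      ⟨fun x => (h.hasDerivAt₁ x).differentiableAt, by simp, by rwa [h.deriv_eq']⟩
    have e0 : ContDiff ℝ (1 + 1 + 1) u := contDiff_succ_iff_deriv.2
      ⟨fun x => (h.hasDerivAt₀ x).differentiableAt, fun h' => absurd h' (by decide),
        by rwa [h.deriv_eq]⟩
    exact e0.of_le (by norm_num)
  · rw [iteratedDeriv_succ, h.iteratedDeriv_two, hd, h.deriv_eq]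
    ring

end SolutionJet

lemma IsSolution.solutionJet {γ : ℂ} {u : ℝ → ℂ} (h : IsSolution γ u) :
    SolutionJet γ u (deriv u) (iteratedDeriv 2 u) := by
  have hd : ∀ n : ℕ, n < 3 → ∀ x, HasDerivAt (iteratedDeriv n u) (iteratedDeriv (n + 1) u x) x := by
    intro n hn x
    rw [iteratedDeriv_succ]
    exact (h.1.differentiable_iteratedDeriv n (by exact_mod_cast hn) x).hasDerivAt
  refine ⟨fun x => ?_, fun x => ?_, fun x => ?_⟩
  · simpa using hd 0 (by norm_num) x
  · simpa using hd 1 (by norm_num) x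
  · rw [show (1 + γ) * u x + (x : ℂ) * deriv u x = iteratedDeriv 3 u x by
      linear_combination h.2 x]
    exact hd 2 (by norm_num) x

namespace SolutionJet

variable {γ : ℂ} {u u₁ u₂ v v₁ v₂ w w₁ w₂ t t₁ t₂ : ℝ → ℂ}

/-- The Wronskian of three solutions, in terms of their jets. -/
lemma wronskian_eq (hu : SolutionJet γ u u₁ u₂) (hv : SolutionJet γ v v₁ v₂)
    (hw : SolutionJet γ w w₁ w₂) (x : ℝ) :
    wronskian ![u, v, w] x = u x * (v₁ x * w₂ x - w₁ x * v₂ x) -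
      v x * (u₁ x * w₂ x - w₁ x * u₂ x) + w x * (u₁ x * v₂ x - v₁ x * u₂ x) := by
  rw [wronskian, Matrix.det_fin_three]
  simp only [Matrix.of_apply, Fin.isValue, Fin.val_zero, Fin.val_one, Fin.val_two,
    Matrix.cons_val_zero, Matrix.cons_val_one, Matrix.cons_val, iteratedDeriv_zero,
    hu.iteratedDeriv_one, hv.iteratedDeriv_one, hw.iteratedDeriv_one, hu.iteratedDeriv_two,
    hv.iteratedDeriv_two, hw.iteratedDeriv_two]
  ring

/-- Abel's identity: the equation has no term of second order, so Wronskians are constant. -/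
lemma wronskian_eq_wronskian_zero (hu : SolutionJet γ u u₁ u₂) (hv : SolutionJet γ v v₁ v₂)
    (hw : SolutionJet γ w w₁ w₂) (x : ℝ) :
    wronskian ![u, v, w] x = wronskian ![u, v, w] 0 := by
  have hd : ∀ x, HasDerivAt (wronskian ![u, v, w]) 0 x := by
    intro x
    rw [funext (hu.wronskian_eq hv hw)]
    have := (((hu.hasDerivAt₀ x).mul (((hv.hasDerivAt₁ x).mul (hw.hasDerivAt₂ x)).sub
      ((hw.hasDerivAt₁ x).mul (hv.hasDerivAt₂ x)))).sub
      ((hv.hasDerivAt₀ x).mul (((hu.hasDerivAt₁ x).mul (hw.hasDerivAt₂ x)).sub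
      ((hw.hasDerivAt₁ x).mul (hu.hasDerivAt₂ x))))).add
      ((hw.hasDerivAt₀ x).mul (((hu.hasDerivAt₁ x).mul (hv.hasDerivAt₂ x)).sub
      ((hv.hasDerivAt₁ x).mul (hu.hasDerivAt₂ x))))
    refine this.congr_deriv ?_
    simp only [Pi.mul_apply, Pi.sub_apply]
    ring
  exact is_const_of_deriv_eq_zero (fun x => (hd x).differentiableAt) (fun x => (hd x).deriv) x 0

/-- Every solution is a combination of three given ones, with Wronskians as coefficients. -/
lemma wronskian_mul (hu : SolutionJet γ u u₁ u₂) (hv : SolutionJet γ v v₁ v₂)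
    (hw : SolutionJet γ w w₁ w₂) (ht : SolutionJet γ t t₁ t₂) (x : ℝ) :
    wronskian ![u, v, w] 0 * t x = wronskian ![t, v, w] 0 * u x + wronskian ![u, t, w] 0 * v x +
      wronskian ![u, v, t] 0 * w x := by
  -- Abel's identity moves all four Wronskians from `0` to `x`, where the claim is Cramer's rule.
  rw [← hu.wronskian_eq_wronskian_zero hv hw x, ← ht.wronskian_eq_wronskian_zero hv hw x,
    ← hu.wronskian_eq_wronskian_zero ht hw x, ← hu.wronskian_eq_wronskian_zero hv ht x,
    hu.wronskian_eq hv hw, ht.wronskian_eq hv hw, hu.wronskian_eq ht hw, hu.wronskian_eq hv ht]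
  ring

/-- Uniqueness for the initial value problem: the coefficients in `wronskian_mul` depend on `t` only
through its 2-jet at `0`. -/
lemma eq_of_jet_eq (hu : SolutionJet γ u u₁ u₂) (hv : SolutionJet γ v v₁ v₂)
    (hw : SolutionJet γ w w₁ w₂) (hW : wronskian ![u, v, w] 0 ≠ 0)
    {t' t₁' t₂' : ℝ → ℂ} (ht : SolutionJet γ t t₁ t₂) (ht' : SolutionJet γ t' t₁' t₂')
    (h0 : t 0 = t' 0) (h1 : t₁ 0 = t₁' 0) (h2 : t₂ 0 = t₂' 0) (x : ℝ) : t x = t' x := by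
  refine mul_left_cancel₀ hW ?_
  rw [hu.wronskian_mul hv hw ht, hu.wronskian_mul hv hw ht', ht.wronskian_eq hv hw,
    hu.wronskian_eq ht hw, hu.wronskian_eq hv ht, ht'.wronskian_eq hv hw,
    hu.wronskian_eq ht' hw, hu.wronskian_eq hv ht', h0, h1, h2]

lemma add (hu : SolutionJet γ u u₁ u₂) (hv : SolutionJet γ v v₁ v₂) :
    SolutionJet γ (u + v) (u₁ + v₁) (u₂ + v₂) := by
  refine ⟨fun x => (hu.hasDerivAt₀ x).add (hv.hasDerivAt₀ x),
    fun x => (hu.hasDerivAt₁ x).add (hv.hasDerivAt₁ x), fun x => ?_⟩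
  refine ((hu.hasDerivAt₂ x).add (hv.hasDerivAt₂ x)).congr_deriv ?_
  simp only [Pi.add_apply]; ring

lemma smul (hu : SolutionJet γ u u₁ u₂) (c : ℂ) : SolutionJet γ (c • u) (c • u₁) (c • u₂) := by
  refine ⟨fun x => (hu.hasDerivAt₀ x).const_smul c, fun x => (hu.hasDerivAt₁ x).const_smul c,
    fun x => ?_⟩
  refine ((hu.hasDerivAt₂ x).const_smul c).congr_deriv ?_
  simp only [Pi.smul_apply, smul_eq_mul]; ring

lemma isFundamentalSystem (hu : SolutionJet γ u u₁ u₂) (hv : SolutionJet γ v v₁ v₂)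
    (hw : SolutionJet γ w w₁ w₂) (hW : wronskian ![u, v, w] 0 ≠ 0) :
    IsFundamentalSystem γ ![u, v, w] := by
  refine ⟨Fintype.linearIndependent_iff.2 fun c hc => ?_, fun t => ⟨fun ht => ?_, fun ht => ?_⟩⟩
  · rw [Fin.sum_univ_three] at hc
    simp only [Matrix.cons_val_zero, Matrix.cons_val_one, Matrix.cons_val] at hc
    have hj := ((hu.smul (c 0)).add (hv.smul (c 1))).add (hw.smul (c 2))
    rw [hc] at hj
    have e1 := hj.deriv_eq
    have e2 := hj.deriv_eq'
    have z1 : deriv (0 : ℝ → ℂ) = 0 := funext fun x => deriv_const x 0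
    rw [z1] at e1
    rw [← e1, z1] at e2
    have h0 := congrFun hc 0
    have h1 := congrFun e1 0
    have h2 := congrFun e2 0
    simp only [Pi.add_apply, Pi.smul_apply, smul_eq_mul, Pi.zero_apply] at h0 h1 h2
    rw [hu.wronskian_eq hv hw] at hW
    intro i
    -- Cramer's rule: combining the three jet equations with the cofactors of one column isolates
    -- the Wronskian times `c i`.
    refine (mul_eq_zero.1 (?_ : _ * c i = 0)).resolve_left hW
    fin_cases i
    · change _ * c 0 = 0
      linear_combination (v₁ 0 * w₂ 0 - w₁ 0 * v₂ 0) * h0 + (v 0 * w₂ 0 - w 0 * v₂ 0) * h1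
        - (v 0 * w₁ 0 - w 0 * v₁ 0) * h2
    · change _ * c 1 = 0
      linear_combination -(u₁ 0 * w₂ 0 - w₁ 0 * u₂ 0) * h0 - (u 0 * w₂ 0 - w 0 * u₂ 0) * h1
        + (u 0 * w₁ 0 - w 0 * u₁ 0) * h2
    · change _ * c 2 = 0
      linear_combination (u₁ 0 * v₂ 0 - v₁ 0 * u₂ 0) * h0 + (u 0 * v₂ 0 - v 0 * u₂ 0) * h1
        - (u 0 * v₁ 0 - v 0 * u₁ 0) * h2
  · refine (Submodule.mem_span_range_iff_exists_fun ℂ).2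
      ⟨![wronskian ![t, v, w] 0 / wronskian ![u, v, w] 0,
        wronskian ![u, t, w] 0 / wronskian ![u, v, w] 0,
        wronskian ![u, v, t] 0 / wronskian ![u, v, w] 0], funext fun x => ?_⟩
    have := hu.wronskian_mul hv hw ht.solutionJet x
    simp only [Fin.sum_univ_three, Matrix.cons_val_zero, Matrix.cons_val_one, Matrix.cons_val,
      Pi.add_apply, Pi.smul_apply, smul_eq_mul]
    field_simp
    linear_combination -this
  · obtain ⟨c, rfl⟩ := (Submodule.mem_span_range_iff_exists_fun ℂ).1 ht
    rw [Fin.sum_univ_three]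
    exact (((hu.smul (c 0)).add (hv.smul (c 1))).add (hw.smul (c 2))).isSolution

/-- The bracket of two solutions solves the equation with parameter `-1 - γ`. -/
lemma bracket (hu : SolutionJet γ u u₁ u₂) (hv : SolutionJet γ v v₁ v₂) :
    SolutionJet (-1 - γ) (bracket u v) (fun x => u x * v₂ x - u₂ x * v x)
      (fun x => u₁ x * v₂ x - u₂ x * v₁ x + (x : ℂ) * (u x * v₁ x - u₁ x * v x)) := by
  have hb : GenAiry.bracket u v = fun x => u x * v₁ x - u₁ x * v x := by
    funext x; rw [GenAiry.bracket, hu.deriv_eq, hv.deriv_eq]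
  have hx : ∀ x : ℝ, HasDerivAt (fun x : ℝ => (x : ℂ)) 1 x := fun x => (hasDerivAt_id x).ofReal_comp
  have hb1 : ∀ x, HasDerivAt (fun x => u x * v₁ x - u₁ x * v x) (u x * v₂ x - u₂ x * v x) x := by
    intro x
    refine (((hu.hasDerivAt₀ x).mul (hv.hasDerivAt₁ x)).sub
      ((hu.hasDerivAt₁ x).mul (hv.hasDerivAt₀ x))).congr_deriv ?_
    ring
  rw [hb]
  refine ⟨hb1, fun x => ?_, fun x => ?_⟩
  · refine (((hu.hasDerivAt₀ x).mul (hv.hasDerivAt₂ x)).sub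
      ((hu.hasDerivAt₂ x).mul (hv.hasDerivAt₀ x))).congr_deriv ?_
    ring
  · refine ((((hu.hasDerivAt₁ x).mul (hv.hasDerivAt₂ x)).sub
      ((hu.hasDerivAt₂ x).mul (hv.hasDerivAt₁ x))).add ((hx x).mul (hb1 x))).congr_deriv ?_
    ring

end SolutionJet

/-! ### The functions as combinations over three rays; the value of the Wronskian. -/

lemma ω_pow_three : ω ^ 3 = 1 := by
  rw [ω, ← Complex.exp_nat_mul, ← Complex.exp_two_pi_mul_I]
  congr 1; push_cast; ring

lemma ω_eq : ω = -1 / 2 + (√3 : ℝ) / 2 * Complex.I := by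
  rw [ω, show 2 * (Real.pi : ℂ) * Complex.I / 3 = ((Real.pi - Real.pi / 3 : ℝ) : ℂ) * Complex.I by
    push_cast; ring, Complex.exp_mul_I, ← Complex.ofReal_cos, ← Complex.ofReal_sin,
    Real.cos_pi_sub, Real.sin_pi_sub, Real.cos_pi_div_three, Real.sin_pi_div_three]
  push_cast; ring

/-- Eliminates `√3`, so that later identities become algebra in `i` and `ω` modulo `i² = -1` and `ω²
= -1 - ω`. -/
lemma sqrt_three_eq : ((√3 : ℝ) : ℂ) = -Complex.I * (2 * ω + 1) := by
  rw [ω_eq]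
  linear_combination ((√3 : ℝ) : ℂ) * Complex.I_sq

lemma ω_sq : ω ^ 2 = -1 - ω := by
  have h3 : ((√3 : ℝ) : ℂ) ^ 2 = 3 := by
    rw [← Complex.ofReal_pow, Real.sq_sqrt (by norm_num)]; norm_num
  rw [ω_eq]
  linear_combination (((√3 : ℝ) : ℂ) ^ 2 / 4) * Complex.I_sq - h3 / 4

/-- A linear combination of the functions `F_γ` along the three rays. -/
noncomputable def rayComb (a b c γ : ℂ) (x : ℝ) : ℂ :=
  a * F γ x + b * F γ (ω * x) + c * F γ (ω ^ 2 * x)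

lemma rayComb_zero (a b c γ : ℂ) : rayComb a b c γ 0 = (a + b + c) * F γ 0 := by
  simp only [rayComb, Complex.ofReal_zero, mul_zero]; ring

lemma hasDerivAt_rayComb {γ : ℂ} (hγ : -1 < γ.re) (a b c : ℂ) (x : ℝ) :
    HasDerivAt (rayComb a b c γ) (rayComb a (b * ω) (c * ω ^ 2) (γ + 1) x) x := by
  have h : ∀ d : ℂ, HasDerivAt (fun x : ℝ => F γ (d * x)) (F (γ + 1) (d * x) * d) x := by
    intro d
    have h1 : HasDerivAt (fun z : ℂ => d * z) d (x : ℂ) := by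
      simpa using (hasDerivAt_id (x : ℂ)).const_mul d
    exact ((hasDerivAt_F hγ (d * x)).comp (x : ℂ) h1).comp_ofReal
  have h1 := h 1
  simp only [one_mul] at h1
  refine (((h1.const_mul a).add ((h ω).const_mul b)).add ((h (ω ^ 2)).const_mul c)).congr_deriv ?_
  rw [rayComb]; ring

/-- Each derivative multiplies the ray coefficients by `1`, `ω`, `ω²`; after three derivatives `ω ^
3 = 1` restores them, and `F_add_three` gives the equation. -/
lemma solutionJet_rayComb {γ : ℂ} (hγ : -1 < γ.re) (a b c : ℂ) :
    SolutionJet γ (rayComb a b c γ) (rayComb a (b * ω) (c * ω ^ 2) (γ + 1))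
      (rayComb a (b * ω ^ 2) (c * ω) (γ + 2)) := by
  refine ⟨hasDerivAt_rayComb hγ a b c, fun x => ?_, fun x => ?_⟩
  · refine (hasDerivAt_rayComb (γ := γ + 1) (by simp; linarith) _ _ _ x).congr_deriv ?_
    rw [rayComb, rayComb, show γ + 1 + 1 = γ + 2 by ring]
    linear_combination c * ω * F (γ + 2) (ω ^ 2 * x) * ω_pow_three
  · refine (hasDerivAt_rayComb (γ := γ + 2) (by simp; linarith) _ _ _ x).congr_deriv ?_
    rw [rayComb, rayComb, rayComb, show γ + 2 + 1 = γ + 3 by ring, F_add_three hγ, F_add_three hγ,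
      F_add_three hγ]
    linear_combination (b * ((γ + 1) * F γ (ω * x) + ω * x * F (γ + 1) (ω * x)) +
      c * ((γ + 1) * F γ (ω ^ 2 * x) + ω ^ 2 * x * F (γ + 1) (ω ^ 2 * x))) * ω_pow_three

lemma Ai_eq_rayComb {γ : ℂ} (hγ : -1 < γ.re) :
    Ai γ = rayComb 0 (phaseFactor γ / (2 * Real.pi)) ((phaseFactor γ)⁻¹ / (2 * Real.pi)) γ := by
  have := Complex.ofReal_ne_zero.2 Real.pi_ne_zero
  have hp := phaseFactor_ne_zero γ
  funext x; rw [Ai_eq hγ, rayComb]; field_simp; ring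

lemma Gi_eq_rayComb {γ : ℂ} (hγ : -1 < γ.re) :
    Gi γ = rayComb 0 (-Complex.I * phaseFactor γ / (2 * Real.pi))
      (Complex.I * (phaseFactor γ)⁻¹ / (2 * Real.pi)) γ := by
  have := Complex.ofReal_ne_zero.2 Real.pi_ne_zero
  have hp := phaseFactor_ne_zero γ
  funext x; rw [Gi_eq hγ, rayComb]; field_simp; ring

lemma Hi_eq_rayComb (γ : ℂ) : Hi γ = rayComb (1 / Real.pi) 0 0 γ := by
  funext x; rw [Hi_eq, rayComb]; ring

/-- The three moments are Gamma values at `z`, `z + 1/3`, `z + 2/3` with `z = (γ + 1)/3`; the powers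
of `3` collect to `1/9`. -/
lemma moment_mul_moment_mul_moment {γ : ℂ} (hγ : -1 < γ.re) :
    F γ 0 * F (γ + 1) 0 * F (γ + 2) 0 * (3 * (√3 : ℝ)) =
      2 * Real.pi * Complex.Gamma (γ + 1) := by
  have h3 : (3 : ℂ) ≠ 0 := three_ne_zero
  have hs : ((√3 : ℝ) : ℂ) ≠ 0 := by simp
  have ht := Gamma_triplication ((γ + 1) / 3)
  rw [show (γ + 1) / 3 + 1 / 3 = (γ + 1 + 1) / 3 by ring,
    show (γ + 1) / 3 + 2 / 3 = (γ + 2 + 1) / 3 by ring,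
    show 3 * ((γ + 1) / 3) = γ + 1 by ring] at ht
  have hp : (3 : ℂ) ^ ((γ + 1) / 3 - 1) * 3 ^ ((γ + 1 + 1) / 3 - 1) * 3 ^ ((γ + 2 + 1) / 3 - 1) *
      (1 / 3) ^ (γ + 1) = 1 / 9 := by
    rw [← Complex.cpow_add _ _ h3, ← Complex.cpow_add _ _ h3, one_div, Complex.inv_cpow,
      ← Complex.cpow_neg, ← Complex.cpow_add _ _ h3]
    · rw [show (γ + 1) / 3 - 1 + ((γ + 1 + 1) / 3 - 1) + ((γ + 2 + 1) / 3 - 1) + -(γ + 1) =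
        ((-2 : ℤ) : ℂ) by push_cast; ring, Complex.cpow_intCast]
      norm_num
    · rw [show (3 : ℂ) = ((3 : ℝ) : ℂ) by norm_num, Complex.arg_ofReal_of_nonneg (by norm_num)]
      exact Real.pi_pos.ne
  rw [F_zero hγ, F_zero (by simp; linarith), F_zero (by simp; linarith)]
  calc _ = ((3 : ℂ) ^ ((γ + 1) / 3 - 1) * 3 ^ ((γ + 1 + 1) / 3 - 1) * 3 ^ ((γ + 2 + 1) / 3 - 1)) *
        (Complex.Gamma ((γ + 1) / 3) * Complex.Gamma ((γ + 1 + 1) / 3) *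
          Complex.Gamma ((γ + 2 + 1) / 3)) * (3 * (√3 : ℝ)) := by ring
    _ = _ := by
      rw [ht]
      have e : (3 * (2 * Real.pi / (√3 : ℝ)) : ℂ) * (3 * (√3 : ℝ)) = 18 * Real.pi := by
        field_simp; norm_num
      linear_combination Complex.Gamma (γ + 1) * (3 * (2 * Real.pi / (√3 : ℝ)) * (3 * (√3 : ℝ))) *
        hp + Complex.Gamma (γ + 1) / 9 * e

/-- At `0` each row of the matrix is one moment times a row of ray coefficients. The determinant is
therefore the product of the moments times a constant in which the phase factors cancel. -/
lemma wronskian_zero {γ : ℂ} (hγ : -1 < γ.re) :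
    wronskian ![Ai γ, Gi γ, Hi γ] 0 = Complex.Gamma (γ + 1) / (Real.pi : ℂ) ^ 2 := by
  have hpi := Complex.ofReal_ne_zero.2 Real.pi_ne_zero
  have hp := phaseFactor_ne_zero γ
  have hm := moment_mul_moment_mul_moment hγ
  rw [Ai_eq_rayComb hγ, Gi_eq_rayComb hγ, Hi_eq_rayComb,
    (solutionJet_rayComb hγ _ _ _).wronskian_eq (solutionJet_rayComb hγ _ _ _)
      (solutionJet_rayComb hγ _ _ _)]
  simp only [rayComb_zero]
  rw [sqrt_three_eq] at hm
  have hI := Complex.I_sq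
  have hω := ω_sq
  generalize Complex.I = i at *
  generalize ω = w at *
  generalize F γ 0 = m₀ at *
  generalize F (γ + 1) 0 = m₁ at *
  generalize F (γ + 2) 0 = m₂ at *
  field_simp
  grind

lemma isFundamentalSystem {γ : ℂ} (hγ : -1 < γ.re) :
    IsFundamentalSystem γ ![Ai γ, Gi γ, Hi γ] := by
  have hW := wronskian_zero hγ
  have h0 : wronskian ![Ai γ, Gi γ, Hi γ] 0 ≠ 0 := by
    rw [hW]
    exact div_ne_zero (Complex.Gamma_ne_zero_of_re_pos (by simp; linarith))
      (pow_ne_zero _ (Complex.ofReal_ne_zero.2 Real.pi_ne_zero))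
  rw [Ai_eq_rayComb hγ, Gi_eq_rayComb hγ, Hi_eq_rayComb] at h0 ⊢
  exact (solutionJet_rayComb hγ _ _ _).isFundamentalSystem (solutionJet_rayComb hγ _ _ _)
      (solutionJet_rayComb hγ _ _ _) h0

lemma wronskian_eq {γ : ℂ} (hγ : -1 < γ.re) (x : ℝ) :
    wronskian ![Ai γ, Gi γ, Hi γ] x = Complex.Gamma (γ + 1) / (Real.pi : ℂ) ^ 2 := by
  rw [← wronskian_zero hγ, Ai_eq_rayComb hγ, Gi_eq_rayComb hγ, Hi_eq_rayComb]
  exact (solutionJet_rayComb hγ _ _ _).wronskian_eq_wronskian_zero (solutionJet_rayComb hγ _ _ _)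
      (solutionJet_rayComb hγ _ _ _) x

lemma rayComb_eq_of_jet_eq {γ : ℂ} (hγ : -1 < γ.re) {t t₁ t₂ : ℝ → ℂ} (ht : SolutionJet γ t t₁ t₂)
    {a b c : ℂ} (h0 : t 0 = (a + b + c) * F γ 0)
    (h1 : t₁ 0 = (a + b * ω + c * ω ^ 2) * F (γ + 1) 0)
    (h2 : t₂ 0 = (a + b * ω ^ 2 + c * ω) * F (γ + 2) 0) (x : ℝ) : t x = rayComb a b c γ x := by
  have h : wronskian ![Ai γ, Gi γ, Hi γ] 0 ≠ 0 := by
    rw [wronskian_zero hγ]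
    exact div_ne_zero (Complex.Gamma_ne_zero_of_re_pos (by simp; linarith))
      (pow_ne_zero _ (Complex.ofReal_ne_zero.2 Real.pi_ne_zero))
  rw [Ai_eq_rayComb hγ, Gi_eq_rayComb hγ, Hi_eq_rayComb] at h
  refine (solutionJet_rayComb hγ _ _ _).eq_of_jet_eq (solutionJet_rayComb hγ _ _ _)
    (solutionJet_rayComb hγ _ _ _) h ht (solutionJet_rayComb hγ a b c) ?_ ?_ ?_ x
  · rw [h0, rayComb_zero]
  · rw [h1, rayComb_zero]
  · rw [h2, rayComb_zero]

/-! ### Brackets via the reflection formula. -/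

/-- Reflection formula for the moments of `γ` and `-1 - γ`. -/
lemma moment_mul_moment {β δ s : ℂ} (hβ : -1 < β.re) (hδ : -1 < δ.re)
    (hs : s = (β + 1) / 3) (h : β + δ = 1) :
    3 * F β 0 * F δ 0 * Complex.sin (Real.pi * s) = Real.pi := by
  have hs0 : 0 < s.re := by
    rw [hs, show (β + 1) / 3 = ((1 / 3 : ℝ) : ℂ) * (β + 1) by push_cast; ring,
      Complex.re_ofReal_mul]
    simp; linarith
  have hs1 : 0 < (1 - s).re := by
    rw [hs, show 1 - (β + 1) / 3 = ((1 / 3 : ℝ) : ℂ) * (δ + 1) by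
      push_cast; linear_combination -h / 3, Complex.re_ofReal_mul]
    simp; linarith
  have hG := Complex.Gamma_mul_Gamma_one_sub s
  have hne := mul_ne_zero (Complex.Gamma_ne_zero_of_re_pos hs0)
    (Complex.Gamma_ne_zero_of_re_pos hs1)
  -- If the sine vanished, the reflection formula with `x / 0 = 0` would make a product of nonzero
  -- Gamma values zero.
  have hsin : Complex.sin (Real.pi * s) ≠ 0 := by
    intro h0; rw [hG, h0, div_zero] at hne; exact hne rfl
  have hp : (3 : ℂ) ^ (s - 1) * 3 ^ ((1 - s) - 1) = 1 / 3 := by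
    rw [← Complex.cpow_add _ _ three_ne_zero, show s - 1 + (1 - s - 1) = -1 by ring,
      Complex.cpow_neg_one]; norm_num
  rw [F_zero hβ, F_zero hδ, ← hs, show (δ + 1) / 3 = 1 - s by rw [hs]; linear_combination h / 3]
  rw [eq_div_iff hsin] at hG
  linear_combination 3 * hG * ((3 : ℂ) ^ (s - 1) * 3 ^ ((1 - s) - 1)) + 3 * Real.pi * hp

lemma exp_pi_div_six : Complex.exp (Complex.I * Real.pi / 6) = -Complex.I * ω := by
  rw [show Complex.I * (Real.pi : ℂ) / 6 = ((Real.pi / 6 : ℝ) : ℂ) * Complex.I by push_cast; ring,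
    Complex.exp_mul_I, ← Complex.ofReal_cos, ← Complex.ofReal_sin, Real.cos_pi_div_six,
    Real.sin_pi_div_six, ω_eq]
  push_cast
  linear_combination ((√3 : ℝ) : ℂ) / 2 * Complex.I_sq

lemma exp_pi_div_three : Complex.exp (Complex.I * Real.pi / 3) = 1 + ω := by
  rw [show Complex.I * (Real.pi : ℂ) / 3 = ((Real.pi / 3 : ℝ) : ℂ) * Complex.I by push_cast; ring,
    Complex.exp_mul_I, ← Complex.ofReal_cos, ← Complex.ofReal_sin, Real.cos_pi_div_three,
    Real.sin_pi_div_three, ω_eq]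
  push_cast; ring

lemma ω_ne_zero : ω ≠ 0 := Complex.exp_ne_zero _

/-- The third part `exp (i π γ / 3)` of the phase. -/
noncomputable def thirdPhase (γ : ℂ) : ℂ := Complex.exp (Complex.I * Real.pi * γ / 3)

lemma thirdPhase_ne_zero (γ : ℂ) : thirdPhase γ ≠ 0 := Complex.exp_ne_zero _

lemma exp_neg_eq_thirdPhase_inv (γ : ℂ) :
    Complex.exp (-(Complex.I * Real.pi * γ / 3)) = (thirdPhase γ)⁻¹ := Complex.exp_neg _

/-- This and the next lemmas write all phases, sines and cosines through `i`, `ω` and `thirdPhase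
γ`, so the bracket identities become rational ones. -/
lemma phaseFactor_eq (γ : ℂ) : phaseFactor γ = -Complex.I * ω * (thirdPhase γ)⁻¹ := by
  rw [phaseFactor, sub_eq_add_neg, Complex.exp_add, exp_neg_eq_thirdPhase_inv, exp_pi_div_six]

lemma phaseFactor_conj (γ : ℂ) : phaseFactor (-1 - γ) = Complex.I * thirdPhase γ := by
  have h : Complex.I * thirdPhase γ =
      Complex.exp (Real.pi * Complex.I / 2) * thirdPhase γ := by rw [exp_pi_half_mul_I]
  rw [h, phaseFactor, thirdPhase, ← Complex.exp_add]
  congr 1; ring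

lemma sin_pi_mul_eq (γ : ℂ) : Complex.sin (Real.pi * γ) =
    ((thirdPhase γ)⁻¹ ^ 3 - thirdPhase γ ^ 3) * Complex.I / 2 := by
  rw [Complex.sin, ← exp_neg_eq_thirdPhase_inv, thirdPhase, ← Complex.exp_nat_mul,
    ← Complex.exp_nat_mul]
  congr 4 <;> push_cast <;> ring

lemma cos_pi_mul_eq (γ : ℂ) : Complex.cos (Real.pi * γ) =
    (thirdPhase γ ^ 3 + (thirdPhase γ)⁻¹ ^ 3) / 2 := by
  rw [Complex.cos, ← exp_neg_eq_thirdPhase_inv, thirdPhase, ← Complex.exp_nat_mul,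
    ← Complex.exp_nat_mul]
  congr 3 <;> push_cast <;> ring

lemma sin_third_zero (γ : ℂ) : Complex.sin (Real.pi * (-γ / 3)) =
    (thirdPhase γ - (thirdPhase γ)⁻¹) * Complex.I / 2 := by
  rw [Complex.sin, ← exp_neg_eq_thirdPhase_inv, thirdPhase]
  congr 4 <;> ring

lemma sin_third_one (γ : ℂ) : Complex.sin (Real.pi * ((1 - γ) / 3)) =
    (-ω * thirdPhase γ - (1 + ω) * (thirdPhase γ)⁻¹) * Complex.I / 2 := by
  have h : -ω = Complex.exp (-(Complex.I * Real.pi / 3)) := by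
    rw [Complex.exp_neg, exp_pi_div_three]
    refine eq_inv_of_mul_eq_one_left ?_
    linear_combination -ω_sq
  rw [Complex.sin, ← exp_neg_eq_thirdPhase_inv, h, ← exp_pi_div_three, thirdPhase,
    ← Complex.exp_add, ← Complex.exp_add]
  congr 4 <;> ring

lemma sin_third_two (γ : ℂ) : Complex.sin (Real.pi * ((2 - γ) / 3)) =
    (ω ^ 2 * thirdPhase γ - ω * (thirdPhase γ)⁻¹) * Complex.I / 2 := by
  have h : ω ^ 2 = Complex.exp (-(2 * Real.pi * Complex.I / 3)) := by
    rw [Complex.exp_neg]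
    refine eq_inv_of_mul_eq_one_left ?_
    rw [← ω, ← pow_succ, ω_pow_three]
  rw [Complex.sin, ← exp_neg_eq_thirdPhase_inv, h, ω, thirdPhase, ← Complex.exp_add,
    ← Complex.exp_add]
  congr 4 <;> ring

/-- Comparison of a product of moments with a moment of the adjoint equation. -/
lemma moment_compare {m m' m'' n G σ s X Y π : ℂ} (hπ : π ≠ 0) (hs : s ≠ 0)
    (hm : m * m' * m'' * (3 * s) = 2 * π * G) (hn : 3 * n * m'' * σ = π)
    (h : 2 * π * σ * X = s * Y) : X * (m * m') = G / π * Y * n := by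
  have h0 : 3 * n * m'' * σ ≠ 0 := by rw [hn]; exact hπ
  have h1 : m'' * σ ≠ 0 := fun h' => h0 (by linear_combination 3 * n * h')
  have h2 : m'' * σ * (3 * s * π) ≠ 0 := by
    refine mul_ne_zero h1 (mul_ne_zero (mul_ne_zero three_ne_zero hs) hπ)
  -- Multiplying by the missing moment `m''` completes the triple product on the left and a
  -- reflection pair `n * m''` on the right.
  refine mul_right_cancel₀ h2 ?_
  have : G / π * Y * n * (m'' * σ * (3 * s * π)) = G * Y * s * (3 * n * m'' * σ) := by
    field_simp
  rw [this, hn]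
  linear_combination X * σ * π * hm + G * π * h

/-- Criterion for a bracket to be a given combination of solutions of the adjoint equation. -/
lemma bracket_rayComb {γ : ℂ} (hγ : -1 < γ.re) (hγ' : γ.re < 0) {a b c a' b' c' A B C : ℂ}
    (h0 : 2 * Real.pi * Complex.sin (Real.pi * (-γ / 3)) *
      ((a + b + c) * (a' + b' * ω + c' * ω ^ 2) - (a + b * ω + c * ω ^ 2) * (a' + b' + c')) =
        (√3 : ℝ) * (A + B + C))
    (h1 : 2 * Real.pi * Complex.sin (Real.pi * ((1 - γ) / 3)) *
      ((a + b + c) * (a' + b' * ω ^ 2 + c' * ω) - (a + b * ω ^ 2 + c * ω) * (a' + b' + c')) =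
        (√3 : ℝ) * (A + B * ω + C * ω ^ 2))
    (h2 : 2 * Real.pi * Complex.sin (Real.pi * ((2 - γ) / 3)) *
      ((a + b * ω + c * ω ^ 2) * (a' + b' * ω ^ 2 + c' * ω) -
        (a + b * ω ^ 2 + c * ω) * (a' + b' * ω + c' * ω ^ 2)) =
        (√3 : ℝ) * (A + B * ω ^ 2 + C * ω)) (x : ℝ) :
    bracket (rayComb a b c γ) (rayComb a' b' c' γ) x =
      Complex.Gamma (1 + γ) / Real.pi * rayComb A B C (-1 - γ) x := by
  have hpi := Complex.ofReal_ne_zero.2 Real.pi_ne_zero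
  have hs : ((√3 : ℝ) : ℂ) ≠ 0 := by simp
  have hm := moment_mul_moment_mul_moment hγ
  rw [add_comm γ 1] at hm
  -- The bracket and its first two derivatives at `0` each involve two of the moments for `γ`, `γ +
  -- 1`, `γ + 2`. The one left out, `γ + 2`, `γ + 1`, `γ` in turn, is the reflection partner of `-1
  -- - γ`, `-γ`, `1 - γ`.
  have n0 := moment_mul_moment (β := -1 - γ) (δ := γ + 2) (s := -γ / 3) (by simp; linarith)
    (by simp; linarith) (by ring) (by ring)
  have n1 := moment_mul_moment (β := -1 - γ + 1) (δ := γ + 1) (s := (1 - γ) / 3)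
    (by simp; linarith) (by simp; linarith) (by ring) (by ring)
  have n2 := moment_mul_moment (β := -1 - γ + 2) (δ := γ) (s := (2 - γ) / 3) (by simp; linarith)
    hγ (by ring) (by ring)
  rw [add_comm γ 1] at n1
  have hsum : Complex.Gamma (1 + γ) / Real.pi * rayComb A B C (-1 - γ) x =
      rayComb (Complex.Gamma (1 + γ) / Real.pi * A) (Complex.Gamma (1 + γ) / Real.pi * B)
        (Complex.Gamma (1 + γ) / Real.pi * C) (-1 - γ) x := by
    simp only [rayComb]; ring
  rw [hsum]
  refine rayComb_eq_of_jet_eq (by simp; linarith)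
    ((solutionJet_rayComb hγ a b c).bracket (solutionJet_rayComb hγ a' b' c')) ?_ ?_ ?_ x
  · rw [bracket, (solutionJet_rayComb hγ a b c).deriv_eq, (solutionJet_rayComb hγ a' b' c').deriv_eq]
    simp only [rayComb_zero]
    rw [add_comm γ 1]
    linear_combination moment_compare hpi hs hm n0 h0
  · simp only [rayComb_zero]
    linear_combination moment_compare (m := F γ 0) (m' := F (γ + 2) 0)
      (G := Complex.Gamma (1 + γ)) hpi hs
      (by linear_combination hm) n1 h1
  · simp only [rayComb_zero, Complex.ofReal_zero, zero_mul, add_zero]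
    rw [add_comm γ 1]
    linear_combination moment_compare (m := F (1 + γ) 0) (m' := F (γ + 2) 0)
      (G := Complex.Gamma (1 + γ)) hpi hs
      (by linear_combination hm) n2 h2

lemma bracket_Ai_Gi {γ : ℂ} (hγ : -1 < γ.re) (hγ' : γ.re < 0) (x : ℝ) :
    bracket (Ai γ) (Gi γ) x = Complex.Gamma (1 + γ) / Real.pi * Ai (-1 - γ) x := by
  have hpi := Complex.ofReal_ne_zero.2 Real.pi_ne_zero
  have hh := thirdPhase_ne_zero γ
  have hI := Complex.I_sq
  have hω := ω_sq
  have hI0 := Complex.I_ne_zero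
  have hω0 := ω_ne_zero
  rw [Ai_eq_rayComb hγ, Gi_eq_rayComb hγ, Ai_eq_rayComb (γ := -1 - γ) (by simp; linarith),
    phaseFactor_conj, phaseFactor_eq]
  refine bracket_rayComb hγ hγ' ?_ ?_ ?_ x
  · rw [sqrt_three_eq, sin_third_zero]
    generalize Complex.I = i at *
    generalize ω = w at *
    generalize thirdPhase γ = h at *
    field_simp
    grind
  · rw [sqrt_three_eq, sin_third_one]
    generalize Complex.I = i at *
    generalize ω = w at *
    generalize thirdPhase γ = h at *
    field_simp
    grind
  · rw [sqrt_three_eq, sin_third_two]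
    generalize Complex.I = i at *
    generalize ω = w at *
    generalize thirdPhase γ = h at *
    field_simp
    grind

lemma bracket_Ai_Hi {γ : ℂ} (hγ : -1 < γ.re) (hγ' : γ.re < 0) (x : ℝ) :
    bracket (Ai γ) (Hi γ) x = Complex.Gamma (1 + γ) / Real.pi *
      (-Complex.cos (Real.pi * γ) * Ai (-1 - γ) x - Complex.sin (Real.pi * γ) * Gi (-1 - γ) x) := by
  have hpi := Complex.ofReal_ne_zero.2 Real.pi_ne_zero
  have hh := thirdPhase_ne_zero γ
  have hI := Complex.I_sq
  have hω := ω_sq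
  have hI0 := Complex.I_ne_zero
  have hω0 := ω_ne_zero
  rw [Ai_eq_rayComb hγ, Hi_eq_rayComb, Ai_eq_rayComb (γ := -1 - γ) (by simp; linarith),
    Gi_eq_rayComb (γ := -1 - γ) (by simp; linarith), phaseFactor_conj, phaseFactor_eq,
    cos_pi_mul_eq, sin_pi_mul_eq]
  -- The coefficients are those of the right-hand side, simplified by `cos ∓ i sin = exp (∓ iπγ)`,
  -- which is the cube of `(thirdPhase γ)⁻¹` or of `thirdPhase γ`.
  refine (bracket_rayComb hγ hγ'
    (A := 0) (B := -(thirdPhase γ)⁻¹ ^ 2 * Complex.I / (2 * Real.pi))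
    (C := thirdPhase γ ^ 2 * Complex.I / (2 * Real.pi)) ?_ ?_ ?_ x).trans ?_
  · rw [sqrt_three_eq, sin_third_zero]
    generalize Complex.I = i at *
    generalize ω = w at *
    generalize thirdPhase γ = h at *
    field_simp
    grind
  · rw [sqrt_three_eq, sin_third_one]
    generalize Complex.I = i at *
    generalize ω = w at *
    generalize thirdPhase γ = h at *
    field_simp
    grind
  · rw [sqrt_three_eq, sin_third_two]
    generalize Complex.I = i at *
    generalize ω = w at *
    generalize thirdPhase γ = h at *
    field_simp
    grind
  · simp only [rayComb]
    generalize Complex.I = i at *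
    generalize thirdPhase γ = h at *
    field_simp
    grind

lemma bracket_Gi_Hi {γ : ℂ} (hγ : -1 < γ.re) (hγ' : γ.re < 0) (x : ℝ) :
    bracket (Gi γ) (Hi γ) x = Complex.Gamma (1 + γ) / Real.pi *
      (Complex.sin (Real.pi * γ) * Ai (-1 - γ) x - Complex.cos (Real.pi * γ) * Gi (-1 - γ) x +
        Hi (-1 - γ) x) := by
  have hpi := Complex.ofReal_ne_zero.2 Real.pi_ne_zero
  have hh := thirdPhase_ne_zero γ
  have hI := Complex.I_sq
  have hω := ω_sq
  have hI0 := Complex.I_ne_zero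
  have hω0 := ω_ne_zero
  rw [Gi_eq_rayComb hγ, Hi_eq_rayComb, Hi_eq_rayComb, Ai_eq_rayComb (γ := -1 - γ) (by simp; linarith),
    Gi_eq_rayComb (γ := -1 - γ) (by simp; linarith), phaseFactor_conj, phaseFactor_eq,
    cos_pi_mul_eq, sin_pi_mul_eq]
  refine (bracket_rayComb hγ hγ'
    (A := 1 / Real.pi) (B := -(thirdPhase γ)⁻¹ ^ 2 / (2 * Real.pi))
    (C := -thirdPhase γ ^ 2 / (2 * Real.pi)) ?_ ?_ ?_ x).trans ?_
  · rw [sqrt_three_eq, sin_third_zero]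
    generalize Complex.I = i at *
    generalize ω = w at *
    generalize thirdPhase γ = h at *
    field_simp
    grind
  · rw [sqrt_three_eq, sin_third_one]
    generalize Complex.I = i at *
    generalize ω = w at *
    generalize thirdPhase γ = h at *
    field_simp
    grind
  · rw [sqrt_three_eq, sin_third_two]
    generalize Complex.I = i at *
    generalize ω = w at *
    generalize thirdPhase γ = h at *
    field_simp
    grind
  · simp only [rayComb]
    generalize Complex.I = i at *
    generalize thirdPhase γ = h at *
    field_simp
    grind

lemma hasOscIntegral_Ai {γ : ℂ} (hγ : -1 < γ.re) (x : ℝ) :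
    HasOscIntegral (aiIntegrand γ x) (Real.pi * Ai γ x) := by
  have h := hasOscIntegral_aiIntegrand hγ x
  rwa [Ai, h.oscIntegral_eq, one_div,
    mul_inv_cancel_left₀ (Complex.ofReal_ne_zero.2 Real.pi_ne_zero)]

lemma hasOscIntegral_Gi {γ : ℂ} (hγ : -1 < γ.re) (x : ℝ) :
    HasOscIntegral (giIntegrand γ x) (Real.pi * Gi γ x) := by
  have h := hasOscIntegral_giIntegrand hγ x
  rwa [Gi, h.oscIntegral_eq, one_div,
    mul_inv_cancel_left₀ (Complex.ofReal_ne_zero.2 Real.pi_ne_zero)]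

end GenAiry

theorem proposition4p1 :
    -- the minors, whenever both `γ` and `-1 - γ` have real part larger than `-1`
    (∀ γ : ℂ, -1 < γ.re → γ.re < 0 → ∀ x : ℝ,
      GenAiry.bracket (GenAiry.Ai γ) (GenAiry.Gi γ) x
          = Complex.Gamma (1 + γ) / (Real.pi : ℂ) * GenAiry.Ai (-1 - γ) x ∧
      GenAiry.bracket (GenAiry.Ai γ) (GenAiry.Hi γ) x
          = Complex.Gamma (1 + γ) / (Real.pi : ℂ) *
            (-Complex.cos ((Real.pi : ℂ) * γ) * GenAiry.Ai (-1 - γ) x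
              - Complex.sin ((Real.pi : ℂ) * γ) * GenAiry.Gi (-1 - γ) x) ∧
      GenAiry.bracket (GenAiry.Gi γ) (GenAiry.Hi γ) x
          = Complex.Gamma (1 + γ) / (Real.pi : ℂ) *
            (Complex.sin ((Real.pi : ℂ) * γ) * GenAiry.Ai (-1 - γ) x
              - Complex.cos ((Real.pi : ℂ) * γ) * GenAiry.Gi (-1 - γ) x
              + GenAiry.Hi (-1 - γ) x)) ∧
    -- the Wronskian and the fundamental system
    (∀ γ : ℂ, -1 < γ.re →
      (∀ x : ℝ, GenAiry.wronskian ![GenAiry.Ai γ, GenAiry.Gi γ, GenAiry.Hi γ] x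
          = Complex.Gamma (γ + 1) / (Real.pi : ℂ) ^ 2) ∧
      GenAiry.IsFundamentalSystem γ ![GenAiry.Ai γ, GenAiry.Gi γ, GenAiry.Hi γ]) ∧
    -- the defining integrals converge, for `Re γ < 2` also as improper integrals
    (∀ γ : ℂ, -1 < γ.re → ∀ x : ℝ,
      GenAiry.HasOscIntegral (GenAiry.aiIntegrand γ x) ((Real.pi : ℂ) * GenAiry.Ai γ x) ∧
      GenAiry.HasOscIntegral (GenAiry.giIntegrand γ x) ((Real.pi : ℂ) * GenAiry.Gi γ x) ∧
      IntegrableOn (GenAiry.hiIntegrand γ x) (Ioi 0) ∧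
      (γ.re < 2 →
        Tendsto (fun R : ℝ => ∫ σ in (0 : ℝ)..R, GenAiry.aiIntegrand γ x σ) atTop
          (𝓝 ((Real.pi : ℂ) * GenAiry.Ai γ x)) ∧
        Tendsto (fun R : ℝ => ∫ σ in (0 : ℝ)..R, GenAiry.giIntegrand γ x σ) atTop
          (𝓝 ((Real.pi : ℂ) * GenAiry.Gi γ x)))) := by
  refine ⟨fun γ h h' x => ⟨GenAiry.bracket_Ai_Gi h h' x, GenAiry.bracket_Ai_Hi h h' x,
    GenAiry.bracket_Gi_Hi h h' x⟩, fun γ h => ⟨GenAiry.wronskian_eq h,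
    GenAiry.isFundamentalSystem h⟩, fun γ h x => ?_⟩
  have hA := GenAiry.hasOscIntegral_Ai h x
  have hG := GenAiry.hasOscIntegral_Gi h x
  refine ⟨hA, hG, ?_, fun h2 => ⟨GenAiry.tendsto_integral_aiIntegrand h h2 hA,
    GenAiry.tendsto_integral_giIntegrand h h2 hG⟩⟩
  rw [GenAiry.hiIntegrand_eq_kernel]
  exact GenAiry.integrableOn_kernel h (by simp) _
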